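/- Let $1\le k<n$ and $\ell_1,\ell_2\ge 0$ be integers with $\ell_1+\ell_2<k$, put $r=n-k$ and $\alpha=r^{\,n-1}$, and let $\mathbb F\supseteq\mathbb B$ be finite fields with $|\mathbb B|\ge n+1$ and $[\mathbb F:\mathbb B]\ge k\alpha$. Let $\gamma$ be a primitive element of $\mathbb B$. **The code.** Index the $\alpha$ coordinates of a node by the digit vectors $a=(a_1,\dots,a_{n-1})\in\{0,\dots,r-1\}^{n-1}$, and let $\oplus$ be addition modulo $r$. For $i\in[n-1]$ let $A_i$ be the $\alpha\times\alpha$ matrix whose row $a$ has its only non-zero entry, equal to $\gamma^i$ if $a_i=0$ and to $1$ otherwise, in the column obtained from $a$ by replacing $a_i$ by $a_i\oplus 1$; let $A_n=I$. Let $H$ be the $r\alpha\times n\alpha$ matrix with blocks $A_j^{\,t}$ ($0\le t\le r-1$, $1\le j\le n$), and let $\mathcal C=\{c\in\mathbb B^{n\alpha}: Hc=0\}$ (the Ye–Barg code). For the repair of node $i\le n-1$ every other node sends its coordinates $a$ with $a_i=0$; for the repair of node $n$ every other node sends its coordinates $a$ with $a_1\oplus\dots\oplus a_{n-1}=0$.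 **The scheme.** Put $M=k\alpha$ and $$M^s=(k-\ell_1-\ell_2)\Bigl(1-\tfrac1{n-k}\Bigr)^{\ell_2}(n-k)^{n-1},$$ which is a natural number. Let $y_1,\dots,y_M\in\mathbb F$ be linearly independent over $\mathbb B$, and let $G$ be a $k\alpha\times n\alpha$ generator matrix of $\mathcal C$ over $\mathbb B$. Given a secure file $f^s\in\mathbb F^{M^s}$, draw $M-M^s$ symbols $\mathbf r$, i.i.d. uniform over $\mathbb F$ and independent of $f^s$, form $\mathbf a=(\mathbf r,f^s)\in\mathbb F^M$ and the linearized polynomial $m_{\mathbf a}(x)=\sum_{i=0}^{M-1}a_{i+1}x^{|\mathbb B|^i}$, and store $(c_1,\dots,c_n)=(m_{\mathbf a}(y_1),\dots,m_{\mathbf a}(y_M))\,G$, with $c_i\in\mathbb F^\alpha$ on node $i$. **Linear repairable MSR schemes.** Consider any (not necessarily linear) injective encoding of a secure file of $M'$ symbols and $M-M'$ random symbols of $\mathbb F$ ($0\le M'\le M$) into $n$ nodes of $\alpha$ symbols each. It is called a linear repairable MSR scheme with $d=n-1$ if any $k$ nodes determine all the others, and each node is exactly determined by $\alpha/(n-k)$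 symbols sent by each of the other $n-1$ nodes, those symbols being $\mathbb F$-linear functions of the content of the sending node. It is secure against an $(\ell_1,\ell_2)$-eavesdropper if, for all $E_1,E_2\subseteq[n]$ with $|E_1|=\ell_1$ and $|E_2|=\ell_2$, the mutual information between the secure file and $e(E_1,E_2)$ is $0$, the random symbols being i.i.d. uniform and independent of the file; here $e(E_1,E_2)$ consists of the content of the nodes in $E_1$ and of all symbols sent for the repairs of the nodes in $E_2$. **Claim.** The code $\mathcal C$ has a $k\alpha\times n\alpha$ generator matrix. For every choice of $y_1,\dots,y_M$ and $G$ as above, the scheme is a linear repairable MSR scheme with $d=n-1$, and it is secure against every $(\ell_1,\ell_2)$-eavesdropper, for every probability distribution of the secure file. Moreover, $M^s$ is the secrecy capacity: it is the largest size $M'$ of a uniformly distributed secure file for which there is a linear repairable MSR scheme over $\mathbb F$ with $n$ nodes, parameters $k$ and $d=n-1$, and $\alpha$ symbols per node that is secure against an $(\ell_1,\ell_2)$-eavesdropper. -/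

import Mathlib

open scoped ENNReal

noncomputable section

/-! ### Mutual information -/

/-- The mutual information `I(X;Y)` of a pair `(X,Y)` with joint law `p`: the Kullback-Leibler
divergence of the joint law from the product of the two marginal laws. It is used for finite `S`
and `T`, which carry the discrete sigma-algebra. -/
def mutualInformation {S T : Type*} (p : PMF (S × T)) : ℝ≥0∞ :=
  letI : MeasurableSpace S := ⊤
  letI : MeasurableSpace T := ⊤
  InformationTheory.klDiv p.toMeasure
    ((p.map Prod.fst).toMeasure.prod (p.map Prod.snd).toMeasure)

/-! ### Coding schemes for distributed storage with linear repair from all other nodes -/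

/-- A coding scheme with `n` storage nodes; a node stores symbols of `F` indexed by `N`. It encodes
a secure file of `Ms` symbols together with `Mr` random symbols. When node `i` is repaired, every
other node `j` computes from its content `x` the symbols `download i j x` (indexed by `Download i`)
and sends them; these are linear functions of `x`. (The values `download i i` play no role.) -/
structure StorageScheme (F : Type*) [Field F] (n : ℕ) (N : Type) (Ms Mr : ℕ) where
  encode : (Fin Ms → F) → (Fin Mr → F) → Fin n → N → F
  Download : Fin n → Type
  finite_download : ∀ i, Finite (Download i)
  download : (i j : Fin n) → (N → F) →ₗ[F] (Download i → F)

namespace StorageScheme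

variable {F : Type*} [Field F] {n : ℕ} {N : Type} {Ms Mr : ℕ}

/-- The set of all codewords `(c_1, …, c_n)` that the scheme can store. -/
def codewords (𝒮 : StorageScheme F n N Ms Mr) : Set (Fin n → N → F) :=
  {c | ∃ s r, 𝒮.encode s r = c}

/-- The scheme operates at the minimum storage regenerating (MSR) point with `d = n - 1` helpers:
it stores `M = k α` symbols in total (secure file and random symbols), where `α = |N|`, any `k`
nodes determine the whole codeword, and every node is exactly repaired from `β = α / (n - k)`
symbols downloaded from each of the `n - 1` other nodes. -/
structure IsMSR (𝒮 : StorageScheme F n N Ms Mr) (k : ℕ) : Prop where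
  size : Mr + Ms = k * Nat.card N
  injective : Function.Injective fun x : (Fin Ms → F) × (Fin Mr → F) => 𝒮.encode x.1 x.2
  reconstruct : ∀ K : Finset (Fin n), K.card = k →
    ∀ c ∈ 𝒮.codewords, ∀ c' ∈ 𝒮.codewords, (∀ j ∈ K, c j = c' j) → c = c'
  bandwidth : ∀ i, (n - k) * Nat.card (𝒮.Download i) = Nat.card N
  repair : ∀ i, ∀ c ∈ 𝒮.codewords, ∀ c' ∈ 𝒮.codewords,
    (∀ j, j ≠ i → 𝒮.download i j (c j) = 𝒮.download i j (c' j)) → c i = c' i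

/-- The observation `e(E₁, E₂)` of the eavesdropper when the codeword `c` is stored: the content of
the nodes in `E₁`, and everything that is downloaded during the repair of the nodes in `E₂`. -/
def observe (𝒮 : StorageScheme F n N Ms Mr) (E₁ E₂ : Finset (Fin n)) (c : Fin n → N → F) :
    (E₁ → N → F) × ((i : E₂) → {j : Fin n // j ≠ i} → 𝒮.Download i → F) :=
  (fun i => c i, fun i j => 𝒮.download i j (c j))

/-- The joint law of the secure file and the observation of the eavesdropper, when the secure file
has law `p` and the random symbols are i.i.d. uniform over `F` and independent of the file. -/
def jointLaw [Fintype F] (𝒮 : StorageScheme F n N Ms Mr) (p : PMF (Fin Ms → F))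
    (E₁ E₂ : Finset (Fin n)) :
    PMF ((Fin Ms → F) ×
      ((E₁ → N → F) × ((i : E₂) → {j : Fin n // j ≠ i} → 𝒮.Download i → F))) :=
  p.bind fun s => (PMF.uniformOfFintype (Fin Mr → F)).map fun r =>
    (s, 𝒮.observe E₁ E₂ (𝒮.encode s r))

/-- Information-theoretic security of a secure file with law `p` against an
`(ℓ₁, ℓ₂)`-eavesdropper: `I(f; e(E₁, E₂)) = 0` for all `E₁`, `E₂` of sizes `ℓ₁`, `ℓ₂`. -/
def IsSecure [Fintype F] (𝒮 : StorageScheme F n N Ms Mr) (p : PMF (Fin Ms → F))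
    (ℓ₁ ℓ₂ : ℕ) : Prop :=
  ∀ E₁ E₂ : Finset (Fin n), E₁.card = ℓ₁ → E₂.card = ℓ₂ →
    mutualInformation (𝒮.jointLaw p E₁ E₂) = 0

end StorageScheme

/-- The sizes of the (uniformly distributed) secure files that linear repairable MSR schemes with
`n` nodes, `d = n - 1`, and node content indexed by `N` store securely against an
`(ℓ₁, ℓ₂)`-eavesdropper. The secrecy capacity is the greatest element. -/
def achievableSizes (F : Type*) [Field F] [Fintype F] (n k : ℕ) (N : Type) (ℓ₁ ℓ₂ : ℕ) : Set ℕ :=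
  {Ms | ∃ (Mr : ℕ) (𝒮 : StorageScheme F n N Ms Mr),
    𝒮.IsMSR k ∧ 𝒮.IsSecure (PMF.uniformOfFintype (Fin Ms → F)) ℓ₁ ℓ₂}

/-! ### Gabidulin precoding -/

/-- The linearized polynomial `∑ i, a_{i+1} x ^ (q ^ i)`, where `i` runs over `0, …, K - 1`. -/
def linearizedPoly {F : Type*} [Field F] (q : ℕ) {K : ℕ} (a : Fin K → F) : Polynomial F :=
  ∑ i : Fin K, Polynomial.C (a i) * Polynomial.X ^ (q ^ (i : ℕ))

/-- Gabidulin precoding of `a` at the points `Y`. -/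
def gabidulinPrecode {F : Type*} [Field F] (q : ℕ) {K : ℕ} (a Y : Fin K → F) : Fin K → F :=
  fun j => (linearizedPoly q a).eval (Y j)

/-! ### The Ye-Barg code

The `n` nodes `1, …, n` are the elements `0, …, n - 1` of `Fin n`. The `α = (n - k) ^ (n - 1)`
coordinates of a node are indexed by the vectors of `n - 1` digits modulo `n - k`; the digits
`1, …, n - 1` are the elements `0, …, n - 2` of `Fin (n - 1)`. -/

namespace YeBarg

/-- The vectors `(a_1, …, a_{n-1})` of digits in `{0, …, n - k - 1}`. -/
abbrev Digits (n k : ℕ) : Type := Fin (n - 1) → Fin (n - k)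

/-- The digit `u ⊕ 1`, addition modulo `r`. -/
def next {r : ℕ} (u : Fin r) : Fin r := ⟨(u.val + 1) % r, Nat.mod_lt _ u.pos⟩

variable {B : Type*} [Field B]

/-- `λ_{i,0} = γ ^ i` and `λ_{i,u} = 1` for `u ≠ 0`; note the shift by one in the index `i`. -/
def coeff (γ : B) {m r : ℕ} (i : Fin m) (u : Fin r) : B :=
  if u.val = 0 then γ ^ (i.val + 1) else 1

/-- The matrix `A_v`. For `v` among the first `n - 1` nodes, row `a` has the single entry
`λ_{v,a_v}` in column `a(v, a_v ⊕ 1)`; for the last node it is the identity. -/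
def blockMatrix (n k : ℕ) (γ : B) (v : Fin n) : Matrix (Digits n k) (Digits n k) B :=
  if h : v.val < n - 1 then
    Matrix.of fun a b =>
      if b = Function.update a ⟨v, h⟩ (next (a ⟨v, h⟩)) then coeff γ (⟨v, h⟩ : Fin (n - 1)) (a ⟨v, h⟩)
      else 0
  else 1

/-- The parity check matrix, whose block in block row `t ∈ {0, …, n-k-1}` and block column `v` is
`A_v ^ t`. -/
def parityCheck (n k : ℕ) (γ : B) :
    Matrix (Fin (n - k) × Digits n k) (Fin n × Digits n k) B :=
  Matrix.of fun x y => (blockMatrix n k γ y.1 ^ (x.1 : ℕ)) x.2 y.2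

/-- The code `C = {c | H c = 0}`. -/
def code (n k : ℕ) (γ : B) : Submodule B (Fin n × Digits n k → B) :=
  LinearMap.ker (parityCheck n k γ).mulVecLin

/-- `G` is a `kα × nα` generator matrix of the code: its rows are a basis of the code. -/
def IsGeneratorMatrix (n k : ℕ) (γ : B)
    (G : Matrix (Fin (k * (n - k) ^ (n - 1))) (Fin n × Digits n k) B) : Prop :=
  LinearIndependent B G.row ∧ Submodule.span B (Set.range G.row) = code n k γ

/-- The coordinates that every helper node sends for the repair of node `v`: those `a` with
`a_v = 0` if `v` is among the first `n - 1` nodes, and those with `a_1 ⊕ ⋯ ⊕ a_{n-1} = 0` if `v` is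
the last node. -/
def IsAccessed (n k : ℕ) (v : Fin n) (a : Digits n k) : Prop :=
  if h : v.val < n - 1 then (a ⟨v, h⟩).val = 0 else (∑ i, (a i).val) % (n - k) = 0

end YeBarg

/-! ### The secure coding scheme -/

/-- The secure file size `(k - ℓ₁ - ℓ₂) (1 - 1/(n-k)) ^ ℓ₂ (n - k) ^ (n-1)`, written as a natural
number. -/
def secureFileSize (n k ℓ₁ ℓ₂ : ℕ) : ℕ :=
  (k - ℓ₁ - ℓ₂) * ((n - k - 1) ^ ℓ₂ * (n - k) ^ (n - 1 - ℓ₂))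

/-- The vector `(r, s)` of length `K`: first the `K - Ms` random symbols, then the secure file. -/
def randomThenFile {F : Type*} {K Ms : ℕ} (s : Fin Ms → F) (r : Fin (K - Ms) → F) : Fin K → F :=
  fun i => if h : i.val < K - Ms then r ⟨i, h⟩ else s ⟨i - (K - Ms), by omega⟩

open YeBarg in
/-- The secure scheme with a secure file of `Ms` symbols: the vector (random symbols, secure file)
is Gabidulin precoded at the points `Y`, and the result is encoded with the generator matrix `G`
over `B`, read over `F`. Nodes are repaired from the accessed coordinates of the other nodes. -/
def secureScheme (n k : ℕ) {B F : Type*} [Field B] [Fintype B] [Field F] [Algebra B F]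
    (Y : Fin (k * (n - k) ^ (n - 1)) → F)
    (G : Matrix (Fin (k * (n - k) ^ (n - 1))) (Fin n × Digits n k) B) (Ms : ℕ) :
    StorageScheme F n (Digits n k) Ms (k * (n - k) ^ (n - 1) - Ms) where
  encode s r := fun v a =>
    Matrix.vecMul (gabidulinPrecode (Fintype.card B) (randomThenFile s r) Y)
      (G.map (algebraMap B F)) (v, a)
  Download v := {a : Digits n k // IsAccessed n k v a}
  finite_download _ := inferInstance
  download _ _ := LinearMap.funLeft F F Subtype.val

end

/-! Both directions rest on interference alignment, a counting fact about MSR codes that needs no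
linearity of the code. Fix a set K of k nodes and i in K. With the rest of K fixed, the downloads
for i from the n - k nodes outside K are an injective function of node i, hence a bijective one by
cardinality (`exists_download_eq`). Consequently, what a node outside K sends for i depends only on
node i and on what the rest of K sends for i (`download_eq_of_download_eq`).

Upper bound. The part of node j that stays hidden when the nodes in A are repaired is measured by
the dimension of `commonKer S A j`. Alignment limits the overlap between the downloads for a further
node i and what is already known (`mul_finrank_quotient_sup_le`), so adding i to A shrinks this
dimension by a factor of at most 1 - 1/(n-k) (`pow_mul_finrank_commonKer_le`). In a secure scheme
every file is compatible with one fixed observation. The resulting codewords are separated by k - ℓ₁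
- ℓ₂ unobserved nodes, on which they differ only by elements of such kernels
(`IsMSR.pow_mul_le_of_isSecure`).

Achievability. The Ye–Barg matrices commute and have invertible differences, because their (n-k)-th
powers are distinct scalars; block Vandermonde elimination then gives the MDS property, and repair
is read off single rows of the parity check. Each stored symbol is the value of the linearized
polynomial at a point of F. If the observed points span at most M - M^s dimensions over B, the
random coefficients can imitate the effect of any file on them. That dimension is bounded by
producing enough codewords that vanish at every observed coordinate (`finrank_ker_restrict_ge`),
where alignment takes care of the nodes outside K. -/

noncomputable section

/-! ### MSR codes with arbitrary alphabets -/

/-- A code of length `n` over the alphabet `X` in which any `k` coordinates are free and determine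
the codeword, and in which coordinate `i` is determined by the values `S i j (c j)`, `j ≠ i`, where
`S i j` takes values in a set of the least possible size. -/
structure IsMSRCode {n : ℕ} {X : Type*} {Y : Fin n → Type*} (C : Set (Fin n → X))
    (S : (i j : Fin n) → X → Y i) (k : ℕ) : Prop where
  exists_eqOn : ∀ K : Finset (Fin n), K.card = k → ∀ x : Fin n → X, ∃ c ∈ C, ∀ j ∈ K, c j = x j
  eq_of_eqOn : ∀ K : Finset (Fin n), K.card = k →
    ∀ c ∈ C, ∀ c' ∈ C, (∀ j ∈ K, c j = c' j) → c = c'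
  repair : ∀ i, ∀ c ∈ C, ∀ c' ∈ C, (∀ j, j ≠ i → S i j (c j) = S i j (c' j)) → c i = c' i
  card_eq : ∀ i, Nat.card X = Nat.card (Y i) ^ (n - k)

namespace IsMSRCode

/-! ### Interference alignment by counting -/

section Alphabet

variable {n k : ℕ} {X : Type*} {Y : Fin n → Type*} {C : Set (Fin n → X)}
  {S : (i j : Fin n) → X → Y i}

/-- By repair, distinct contents of node `i` give distinct downloads from the `n - k` nodes outside
`K`; `card_eq` makes this injection a bijection. -/
theorem exists_download_eq [Finite X] [∀ i, Finite (Y i)] (h : IsMSRCode C S k)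
    {K : Finset (Fin n)} (hK : K.card = k) {i : Fin n} (hi : i ∈ K) (x : Fin n → X)
    (z : Fin n → Y i) :
    ∃ c ∈ C, (∀ j ∈ K, j ≠ i → c j = x j) ∧ ∀ p ∉ K, S i p (c p) = z p := by
  choose cw hcw hcw' using fun y : X => h.exists_eqOn K hK (Function.update x i y)
  have hinj : Function.Injective
      (fun (y : X) (p : {p // p ∉ K}) => S i p (cw y p)) := by
    intro y y' hyy
    have : cw y i = cw y' i := by
      refine h.repair i _ (hcw y) _ (hcw y') fun j hj => ?_
      by_cases hjK : j ∈ K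
      · rw [hcw' y j hjK, hcw' y' j hjK, Function.update_of_ne hj, Function.update_of_ne hj]
      · exact congrFun hyy ⟨j, hjK⟩
    rw [hcw' y i hi, hcw' y' i hi] at this
    simpa using this
  have hcard : Nat.card ({p // p ∉ K} → Y i) = Nat.card X := by
    rw [Nat.card_fun, h.card_eq i]
    congr 1
    rw [Nat.card_eq_fintype_card, Fintype.card_subtype_compl]
    simp [hK]
  obtain ⟨y, hy⟩ := (hinj.bijective_of_nat_card_le hcard.le).2 fun p => z p
  refine ⟨cw y, hcw y, fun j hj hji => ?_, fun p hp => congrFun hy ⟨p, hp⟩⟩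
  rw [hcw' y j hj, Function.update_of_ne hji]

/-- Interference alignment: the symbols downloaded outside of `K` for the repair of `i ∈ K` only
depend on node `i` and on the symbols downloaded from the other nodes in `K`. -/
theorem download_eq_of_download_eq [Finite X] [∀ i, Finite (Y i)] (h : IsMSRCode C S k)
    {K : Finset (Fin n)} (hK : K.card = k) {i : Fin n} (hi : i ∈ K) {c c' : Fin n → X}
    (hc : c ∈ C) (hc' : c' ∈ C) (hci : c i = c' i)
    (hS : ∀ j ∈ K, j ≠ i → S i j (c j) = S i j (c' j)) {p : Fin n} (hp : p ∉ K) :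
    S i p (c p) = S i p (c' p) := by
  -- The hybrid `d` follows `c` on the rest of `K` and imitates the downloads of `c'` outside `K`.
  -- Repair forces `d i = c' i = c i`, so `d` is `c`.
  obtain ⟨d, hd, hdK, hdp⟩ := h.exists_download_eq hK hi c fun p => S i p (c' p)
  have hdi : d i = c' i := by
    refine h.repair i _ hd _ hc' fun j hj => ?_
    by_cases hjK : j ∈ K
    · rw [hdK j hjK hj, hS j hjK hj]
    · exact hdp j hjK
  have hdc : d = c := by
    refine h.eq_of_eqOn K hK _ hd _ hc fun j hj => ?_
    rcases eq_or_ne j i with rfl | hji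
    · rw [hdi, hci]
    · exact hdK j hj hji
  rw [← hdc]
  exact hdp p hp

/-- Given the other nodes of a set of `k` nodes, the content of node `p` is an injective function
of the content of node `j`, and this respects the equality of downloads for the repair of those
nodes. -/
theorem exists_transfer [Finite X] [∀ i, Finite (Y i)] (h : IsMSRCode C S k)
    {K : Finset (Fin n)} (hK : K.card = k) {j p : Fin n} (hj : j ∈ K) (hp : p ∉ K)
    (c₀ : Fin n → X) :
    ∃ g : X → X, Function.Injective g ∧
      ∀ i ∈ K, i ≠ j → ∀ x x', S i j x = S i j x' → S i p (g x) = S i p (g x') := by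
  choose cw hcw hcw' using fun y : X => h.exists_eqOn K hK (Function.update c₀ j y)
  have hother : ∀ y y' : X, ∀ m ∈ K, m ≠ j → cw y m = cw y' m := fun y y' m hm hmj => by
    rw [hcw' y m hm, hcw' y' m hm, Function.update_of_ne hmj, Function.update_of_ne hmj]
  have hself : ∀ y, cw y j = y := fun y => by rw [hcw' y j hj, Function.update_self]
  refine ⟨fun y => cw y p, fun y y' hyy => ?_, fun i hi hij x x' hx => ?_⟩
  · have : cw y = cw y' := by
      refine h.eq_of_eqOn (insert p (K.erase j)) ?_ _ (hcw y) _ (hcw y') fun m hm => ?_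
      · rw [Finset.card_insert_of_notMem (by simp [hp]), Finset.card_erase_add_one hj, hK]
      · rcases Finset.mem_insert.1 hm with rfl | hm
        · exact hyy
        · exact hother y y' m (Finset.mem_of_mem_erase hm) (Finset.ne_of_mem_erase hm)
    rw [← hself y, this, hself]
  · refine h.download_eq_of_download_eq hK hi (hcw x) (hcw x') (hother x x' i hi hij)
      (fun m hm hmi => ?_) hp
    rcases eq_or_ne m j with rfl | hmj
    · rw [hself, hself, hx]
    · rw [hother x x' m hm hmj]

end Alphabet

/-! ### Dimension bounds for linear downloads -/

section Linear

variable {n k : ℕ} {F : Type*} [Field F] {V : Type*} [AddCommGroup V] [Module F V]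
  {W : Fin n → Type*} [∀ i, AddCommGroup (W i)] [∀ i, Module F (W i)]
  {C : Set (Fin n → V)} {S : (i j : Fin n) → V →ₗ[F] W i}

variable (S) in
/-- The contents of node `j` for which all symbols sent for the repair of the nodes in `A`
vanish. -/
def commonKer (A : Finset (Fin n)) (j : Fin n) : Submodule F V := ⨅ i ∈ A, LinearMap.ker (S i j)

theorem mem_commonKer {A : Finset (Fin n)} {j : Fin n} {x : V} :
    x ∈ commonKer S A j ↔ ∀ i ∈ A, S i j x = 0 := by
  simp [commonKer, Submodule.mem_iInf]

variable [Finite V] [∀ i, Finite (W i)]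

theorem download_surjective (h : IsMSRCode C (fun i j => S i j) k) (hk : 1 ≤ k) (hkn : k < n)
    {i p : Fin n} (hp : p ≠ i) : Function.Surjective (S i p) := by
  intro z
  obtain ⟨K, hiK, hKp, hK⟩ := Finset.exists_subsuperset_card_eq
    (s := {i}) (t := Finset.univ.erase p) (n := k)
    (by simpa using hp.symm) (by simpa using hk)
    (by rw [Finset.card_erase_of_mem (Finset.mem_univ _), Finset.card_univ, Fintype.card_fin]
        omega)
  obtain ⟨c, -, -, hc⟩ := h.exists_download_eq hK (hiK (Finset.mem_singleton_self i)) 0 fun _ => z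
  exact ⟨c p, hc p fun hpK => (Finset.mem_erase.1 (hKp hpK)).1 rfl⟩

variable [Finite F]

/-- The code may be nonlinear, so `g` is only an injection; over a finite field, counting elements
still compares dimensions. -/
theorem _root_.Submodule.finrank_le_of_injective_of_sub_mem {P Q : Submodule F V} {g : V → V}
    (hg : Function.Injective g) (h : ∀ x ∈ P, g x - g 0 ∈ Q) :
    Module.finrank F P ≤ Module.finrank F Q := by
  have hinj : Function.Injective (fun x : P => (⟨g x - g 0, h x x.2⟩ : Q)) := by
    intro x y hxy
    have := congrArg Subtype.val hxy
    exact Subtype.ext (hg (sub_left_injective this))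
  have hcard := Nat.card_le_card_of_injective _ hinj
  rw [Module.natCard_eq_pow_finrank (K := F) (V := P),
    Module.natCard_eq_pow_finrank (K := F) (V := Q)] at hcard
  exact (Nat.pow_le_pow_iff_right Finite.one_lt_card).1 hcard

/-- The map `g` comes from `exists_transfer` for a set `K` containing `A` and `j` but not `p`. When
the hypotheses are symmetric in `j` and `p`, applying this both ways gives equal dimensions. -/
theorem finrank_le_finrank_of_closed (h : IsMSRCode C (fun i j => S i j) k) (hkn : k < n)
    {A : Finset (Fin n)} {j p : Fin n} (hA : A.card + 1 ≤ k) (hj : j ∉ A) (hp : p ∉ A)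
    {P Q : Submodule F V}
    (hPQ : ∀ g : V → V,
      (∀ i ∈ A, ∀ x x', S i j x = S i j x' → S i p (g x) = S i p (g x')) →
      ∀ x ∈ P, g x - g 0 ∈ Q) (hjp : j ≠ p) :
    Module.finrank F P ≤ Module.finrank F Q := by
  obtain ⟨K, hAK, hKp, hK⟩ := Finset.exists_subsuperset_card_eq
    (s := insert j A) (t := Finset.univ.erase p) (n := k)
    (fun m hm => by
      rw [Finset.mem_erase]
      refine ⟨?_, Finset.mem_univ _⟩
      rintro rfl
      rcases Finset.mem_insert.1 hm with h | h
      · exact hjp h.symm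
      · exact hp h)
    (by rwa [Finset.card_insert_of_notMem hj])
    (by rw [Finset.card_erase_of_mem (Finset.mem_univ _), Finset.card_univ, Fintype.card_fin]
        omega)
  obtain ⟨g, hg, hgS⟩ := h.exists_transfer hK (hAK (Finset.mem_insert_self _ _))
    (fun hpK => (Finset.mem_erase.1 (hKp hpK)).1 rfl) 0
  refine Submodule.finrank_le_of_injective_of_sub_mem hg (hPQ g fun i hi => hgS i ?_ ?_)
  · exact hAK (Finset.mem_insert_of_mem hi)
  · rintro rfl
    exact hj hi

theorem finrank_commonKer_le (h : IsMSRCode C (fun i j => S i j) k) (hkn : k < n)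
    {A : Finset (Fin n)} {j p : Fin n} (hA : A.card + 1 ≤ k) (hj : j ∉ A) (hp : p ∉ A) :
    Module.finrank F (commonKer S A j) ≤ Module.finrank F (commonKer S A p) := by
  rcases eq_or_ne j p with rfl | hjp
  · rfl
  refine h.finrank_le_finrank_of_closed hkn hA hj hp (fun g hg x hx => ?_) hjp
  rw [mem_commonKer] at hx ⊢
  intro i hi
  rw [map_sub, sub_eq_zero]
  exact hg i hi _ _ (by rw [hx i hi, map_zero])

theorem finrank_commonKer_sup_le (h : IsMSRCode C (fun i j => S i j) k) (hkn : k < n)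
    {A : Finset (Fin n)} {i j p : Fin n} (hA : A.card + 2 ≤ k) (hj : j ∉ insert i A)
    (hp : p ∉ insert i A) :
    Module.finrank F ↥(commonKer S A j ⊔ LinearMap.ker (S i j)) ≤
      Module.finrank F ↥(commonKer S A p ⊔ LinearMap.ker (S i p)) := by
  rcases eq_or_ne j p with rfl | hjp
  · rfl
  refine h.finrank_le_finrank_of_closed hkn ((Nat.succ_le_succ (Finset.card_insert_le _ _)).trans hA)
    hj hp (fun g hg x hx => ?_) hjp
  obtain ⟨u, hu, w, hw, rfl⟩ := Submodule.mem_sup.1 hx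
  -- Without additivity of `g`, the path from `0` to `u + w` goes through `w`: the first step
  -- changes only `u`, the second only `w`.
  rw [← sub_add_sub_cancel _ (g w)]
  refine Submodule.add_mem_sup ?_ ?_
  · rw [mem_commonKer] at hu ⊢
    intro m hm
    rw [map_sub, sub_eq_zero]
    exact hg m (Finset.mem_insert_of_mem hm) _ _ (by rw [map_add, hu m hm, zero_add])
  · rw [LinearMap.mem_ker] at hw ⊢
    rw [map_sub, sub_eq_zero]
    exact hg i (Finset.mem_insert_self _ _) _ _ (by rw [hw, map_zero])

/-- The parts of the downloads for the repair of node `i` that are also known from the repair of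
the nodes in `A` are independent functions of what the latter reveals about node `i`. -/
theorem mul_finrank_quotient_sup_le (h : IsMSRCode C (fun i j => S i j) k) (hkn : k < n)
    {A : Finset (Fin n)} {i j : Fin n} (hA : A.card + 2 ≤ k) (hi : i ∉ A) (hj : j ∉ insert i A) :
    (n - k) * Module.finrank F (V ⧸ (commonKer S A j ⊔ LinearMap.ker (S i j))) ≤
      Module.finrank F (V ⧸ commonKer S A i) := by
  obtain ⟨K, hAK, -, hK⟩ := Finset.exists_subsuperset_card_eq
    (s := insert i A) (t := Finset.univ) (n := k) (Finset.subset_univ _)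
    ((Finset.card_insert_le _ _).trans (by omega))
    (by rw [Finset.card_univ, Fintype.card_fin]; omega)
  have hiK : i ∈ K := hAK (Finset.mem_insert_self _ _)
  choose cw hcw hcw' using fun y : V => h.exists_eqOn K hK (Function.update 0 i y)
  let P : Fin n → Submodule F V := fun p => commonKer S A p ⊔ LinearMap.ker (S i p)
  have hfac : ∀ x x' : V, x - x' ∈ commonKer S A i → ∀ p ∉ K, cw x p - cw x' p ∈ P p := by
    intro x x' hx p hp
    refine Submodule.mem_sup_left ?_
    rw [mem_commonKer] at hx ⊢
    intro m hm
    have hmi : m ≠ i := by rintro rfl; exact hi hm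
    have hmK : m ∈ K := hAK (Finset.mem_insert_of_mem hm)
    rw [map_sub, sub_eq_zero]
    refine h.download_eq_of_download_eq hK hmK (hcw x) (hcw x') ?_ (fun l hl hlm => ?_) hp
    · rw [hcw' x m hmK, hcw' x' m hmK, Function.update_of_ne hmi, Function.update_of_ne hmi]
    · rw [hcw' x l hl, hcw' x' l hl]
      rcases eq_or_ne l i with rfl | hli
      · rw [Function.update_self, Function.update_self, ← sub_eq_zero, ← map_sub, hx m hm]
      · rw [Function.update_of_ne hli, Function.update_of_ne hli]
  -- Only node `i` of `K` varies. Alignment for the nodes of `A` makes the class at `p` independent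
  -- of the representative; surjectivity holds because the downloads for `i` outside `K` can be
  -- prescribed.
  let f : V ⧸ commonKer S A i → (p : {p // p ∉ K}) → V ⧸ P p :=
    fun q => Quotient.liftOn' q (fun x p => Submodule.Quotient.mk (cw x p)) fun x x' hx => by
      funext p
      rw [Submodule.Quotient.eq]
      exact hfac x x' ((Submodule.quotientRel_def _).1 hx) p p.2
  have hf : Function.Surjective f := by
    intro z
    choose v hv using fun p => Submodule.Quotient.mk_surjective _ (z p)
    obtain ⟨c, hc, hcK, hcp⟩ := h.exists_download_eq hK hiK 0
      (fun p => if hp : p ∉ K then S i p (v ⟨p, hp⟩) else 0)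
    refine ⟨Submodule.Quotient.mk (c i), ?_⟩
    have hcc : cw (c i) = c := by
      refine h.eq_of_eqOn K hK _ (hcw _) _ hc fun l hl => ?_
      rw [hcw' _ l hl]
      rcases eq_or_ne l i with rfl | hli
      · rw [Function.update_self]
      · rw [Function.update_of_ne hli, hcK l hl hli]
    funext p
    change Submodule.Quotient.mk (cw (c i) p) = z p
    rw [← hv p, Submodule.Quotient.eq, hcc]
    refine Submodule.mem_sup_right ?_
    rw [LinearMap.mem_ker, map_sub, sub_eq_zero]
    have := hcp p p.2
    rwa [dif_pos p.2] at this
  have : Finite (V ⧸ commonKer S A i) := Finite.of_surjective _ (Submodule.mkQ_surjective _)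
  have hcard := Nat.card_le_card_of_surjective f hf
  have hfin : ∀ p : {p // p ∉ K}, Module.finrank F (V ⧸ P j) ≤ Module.finrank F (V ⧸ P p) := by
    intro p
    have hle : Module.finrank F (P p) ≤ Module.finrank F (P j) :=
      h.finrank_commonKer_sup_le hkn hA (fun hp => p.2 (hAK hp)) hj
    have h1 := (P p).finrank_quotient_add_finrank
    have h2 := (P j).finrank_quotient_add_finrank
    omega
  rw [Nat.card_pi, Module.natCard_eq_pow_finrank (K := F) (V := V ⧸ commonKer S A i)] at hcard
  simp_rw [Module.natCard_eq_pow_finrank (K := F) (V := V ⧸ P _)] at hcard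
  rw [Finset.prod_pow_eq_pow_sum, Nat.pow_le_pow_iff_right Finite.one_lt_card] at hcard
  refine le_trans ?_ hcard
  calc _ = ∑ _p : {p // p ∉ K}, Module.finrank F (V ⧸ P j) := by
        rw [Finset.sum_const, Finset.card_univ, Fintype.card_subtype_compl]
        simp [hK, P]
    _ ≤ _ := Finset.sum_le_sum fun p _ => hfin p

/-- The repair of the nodes in `A` reveals at least a fraction `1 - (1 - 1 / (n - k)) ^ |A|` of the
content of every other node. -/
theorem pow_mul_finrank_commonKer_le (h : IsMSRCode C (fun i j => S i j) k) (hkn : k < n)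
    (A : Finset (Fin n)) : ∀ j ∉ A, A.card + 1 ≤ k →
    (n - k) ^ A.card * Module.finrank F (commonKer S A j) ≤
      (n - k - 1) ^ A.card * Module.finrank F V := by
  induction A using Finset.induction_on with
  | empty => intro j _ _; simpa using Submodule.finrank_le _
  | insert i A hi ih =>
    intro j hj hA
    rw [Finset.card_insert_of_notMem hi] at hA ⊢
    have hjA : j ∉ A := fun hjA => hj (Finset.mem_insert_of_mem hjA)
    have hji : j ≠ i := by rintro rfl; exact hj (Finset.mem_insert_self _ _)
    have hih := ih j hjA (by omega)
    have hsup := h.mul_finrank_quotient_sup_le hkn (by omega) hi hj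
    have hsurj := h.download_surjective (by omega) hkn hji
    have hU : Module.finrank F (commonKer S A j) = Module.finrank F (commonKer S A i) :=
      le_antisymm (h.finrank_commonKer_le hkn (by omega) hjA hi)
        (h.finrank_commonKer_le hkn (by omega) hi hjA)
    have hinf : commonKer S (insert i A) j = commonKer S A j ⊓ LinearMap.ker (S i j) := by
      ext x
      simp [mem_commonKer, and_comm]
    have hdim := Submodule.finrank_sup_add_finrank_inf_eq (commonKer S A j)
      (LinearMap.ker (S i j))
    have hrn := (S i j).finrank_range_add_finrank_ker
    rw [LinearMap.range_eq_top.2 hsurj, finrank_top] at hrn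
    have hq1 := (commonKer S A j ⊔ LinearMap.ker (S i j)).finrank_quotient_add_finrank
    have hq2 := (commonKer S A i).finrank_quotient_add_finrank
    have hW : Module.finrank F V = Module.finrank F (W i) * (n - k) := by
      have := h.card_eq i
      rw [Module.natCard_eq_pow_finrank (K := F) (V := V),
        Module.natCard_eq_pow_finrank (K := F) (V := W i), ← pow_mul] at this
      exact Nat.pow_right_injective (Finite.one_lt_card (α := F)) this
    rw [hinf]
    obtain ⟨r, hr⟩ : ∃ r, n - k = r + 1 := ⟨n - k - 1, by omega⟩
    rw [hr] at hih hsup hW ⊢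
    rw [Nat.add_sub_cancel] at hih ⊢
    -- With `dim V = (r + 1) dim W` and `dim ker = dim V - dim W`, the dimension formula for sup and
    -- inf turns `hsup` into this bound; `hU` moves the kernel from node `i` to node `j`.
    have key : (r + 1) * Module.finrank F ↥(commonKer S A j ⊓ LinearMap.ker (S i j)) ≤
        r * Module.finrank F (commonKer S A j) := by
      nlinarith
    calc _ = (r + 1) ^ A.card * ((r + 1) *
          Module.finrank F ↥(commonKer S A j ⊓ LinearMap.ker (S i j))) := by ring
      _ ≤ (r + 1) ^ A.card * (r * Module.finrank F (commonKer S A j)) :=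
          Nat.mul_le_mul_left _ key
      _ = r * ((r + 1) ^ A.card * Module.finrank F (commonKer S A j)) := by ring
      _ ≤ r * (r ^ A.card * Module.finrank F V) := Nat.mul_le_mul_left _ hih
      _ = _ := by ring

end Linear

end IsMSRCode

/-! ### Independence of finite random variables -/

theorem mutualInformation_eq_zero_iff {S T : Type*} [Countable S] [Countable T]
    (p : PMF (S × T)) :
    mutualInformation p = 0 ↔ ∀ s t, p (s, t) = p.map Prod.fst s * p.map Prod.snd t := by
  let _ : MeasurableSpace S := ⊤
  let _ : MeasurableSpace T := ⊤
  have : MeasurableSingletonClass S := ⟨fun _ => trivial⟩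
  have : MeasurableSingletonClass T := ⟨fun _ => trivial⟩
  unfold mutualInformation
  rw [InformationTheory.klDiv_eq_zero_iff, MeasureTheory.Measure.ext_iff_singleton, Prod.forall]
  refine forall₂_congr fun s t => ?_
  rw [PMF.toMeasure_apply_singleton _ _ (measurableSet_singleton _), ← Set.singleton_prod_singleton,
    MeasureTheory.Measure.prod_prod,
    PMF.toMeasure_apply_singleton _ _ (measurableSet_singleton _),
    PMF.toMeasure_apply_singleton _ _ (measurableSet_singleton _)]

/-- Independence makes the support a rectangle. -/
theorem mem_support_of_mutualInformation_eq_zero {S T : Type*} [Countable S] [Countable T]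
    {p : PMF (S × T)} (h : mutualInformation p = 0) {s s' : S} {t t' : T}
    (hs : (s, t) ∈ p.support) (ht : (s', t') ∈ p.support) : (s, t') ∈ p.support := by
  rw [PMF.mem_support_iff, (mutualInformation_eq_zero_iff p).1 h]
  refine mul_ne_zero ?_ ?_
  · rw [← PMF.mem_support_iff, PMF.mem_support_map_iff]
    exact ⟨_, hs, rfl⟩
  · rw [← PMF.mem_support_iff, PMF.mem_support_map_iff]
    exact ⟨_, ht, rfl⟩

theorem mutualInformation_bind_map_mk {S T : Type*} [Countable S] [Countable T] (p : PMF S)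
    (ν : PMF T) : mutualInformation (p.bind fun s => ν.map (Prod.mk s)) = 0 := by
  classical
  rw [mutualInformation_eq_zero_iff]
  intro s t
  have hfst : (p.bind fun s => ν.map (Prod.mk s)).map Prod.fst = p := by
    simp_rw [PMF.map_bind, PMF.map_comp]
    exact (congrArg p.bind (funext fun s => PMF.map_const ν s)).trans p.bind_pure
  have hsnd : (p.bind fun s => ν.map (Prod.mk s)).map Prod.snd = ν := by
    simp_rw [PMF.map_bind, PMF.map_comp]
    exact (congrArg p.bind (funext fun _ => PMF.map_id ν)).trans (p.bind_const ν)
  rw [hfst, hsnd, PMF.bind_apply, tsum_eq_single s, PMF.map_apply, tsum_eq_single t]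
  · simp
  · intro t' ht'
    simp [ht'.symm]
  · intro s' hs'
    rw [PMF.map_apply]
    simp [hs'.symm]

theorem PMF.map_uniformOfFintype_of_bijective {α : Type*} [Fintype α] [Nonempty α] {f : α → α}
    (hf : Function.Bijective f) :
    (PMF.uniformOfFintype α).map f = PMF.uniformOfFintype α := by
  classical
  ext a
  obtain ⟨b, rfl⟩ := hf.2 a
  rw [PMF.map_apply, tsum_eq_single b]
  · simp
  · intro b' hb'
    simp [hf.1.ne hb'.symm]

namespace StorageScheme

variable {F : Type*} [Field F] [Fintype F] {n : ℕ} {N : Type} {Ms Mr : ℕ}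

theorem mem_support_jointLaw_iff (𝒮 : StorageScheme F n N Ms Mr) (p : PMF (Fin Ms → F))
    (E₁ E₂ : Finset (Fin n)) (s : Fin Ms → F) (e) :
    (s, e) ∈ (𝒮.jointLaw p E₁ E₂).support ↔
      s ∈ p.support ∧ ∃ r, 𝒮.observe E₁ E₂ (𝒮.encode s r) = e := by
  rw [jointLaw, PMF.mem_support_bind_iff]
  simp only [PMF.mem_support_map_iff, PMF.mem_support_uniformOfFintype, true_and, Prod.mk.injEq]
  constructor
  · rintro ⟨s', hs', r, rfl, hr⟩
    exact ⟨hs', r, hr⟩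
  · rintro ⟨hs, r, hr⟩
    exact ⟨s, hs, r, rfl, hr⟩

/-- Every observation of an eavesdropper is consistent with every file, if the scheme is secure. -/
theorem IsSecure.exists_observe_eq [Finite N] {𝒮 : StorageScheme F n N Ms Mr} {ℓ₁ ℓ₂ : ℕ}
    (h : 𝒮.IsSecure (PMF.uniformOfFintype (Fin Ms → F)) ℓ₁ ℓ₂) {E₁ E₂ : Finset (Fin n)}
    (hE₁ : E₁.card = ℓ₁) (hE₂ : E₂.card = ℓ₂) (s s' : Fin Ms → F) (r' : Fin Mr → F) :
    ∃ r, 𝒮.observe E₁ E₂ (𝒮.encode s r) = 𝒮.observe E₁ E₂ (𝒮.encode s' r') := by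
  have := 𝒮.finite_download
  have hmem : ∀ s r, (s, 𝒮.observe E₁ E₂ (𝒮.encode s r)) ∈
      (𝒮.jointLaw (PMF.uniformOfFintype (Fin Ms → F)) E₁ E₂).support := fun s r => by
    rw [mem_support_jointLaw_iff]
    exact ⟨PMF.mem_support_uniformOfFintype s, r, rfl⟩
  have := mem_support_of_mutualInformation_eq_zero (h E₁ E₂ hE₁ hE₂) (hmem s 0) (hmem s' r')
  exact ((mem_support_jointLaw_iff _ _ _ _ _ _).1 this).2

/-- A scheme is secure if changing the file has the same effect on each observation as a
translation of the random symbols. -/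
theorem isSecure_of_forall_exists_add [Finite N] (𝒮 : StorageScheme F n N Ms Mr) {ℓ₁ ℓ₂ : ℕ}
    (h : ∀ E₁ E₂ : Finset (Fin n), E₁.card = ℓ₁ → E₂.card = ℓ₂ → ∀ s, ∃ r₀, ∀ r,
      𝒮.observe E₁ E₂ (𝒮.encode s r) = 𝒮.observe E₁ E₂ (𝒮.encode 0 (r + r₀)))
    (p : PMF (Fin Ms → F)) : 𝒮.IsSecure p ℓ₁ ℓ₂ := by
  intro E₁ E₂ hE₁ hE₂
  have := 𝒮.finite_download
  choose r₀ hr₀ using h E₁ E₂ hE₁ hE₂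
  have : 𝒮.jointLaw p E₁ E₂ = p.bind fun s =>
      ((PMF.uniformOfFintype (Fin Mr → F)).map
        fun r => 𝒮.observe E₁ E₂ (𝒮.encode 0 r)).map (Prod.mk s) := by
    unfold jointLaw
    congr 1
    funext s
    -- The uniform law is invariant under translation by `r₀ s`, which absorbs the dependence on the
    -- file.
    conv_rhs => rw [← PMF.map_uniformOfFintype_of_bijective (Equiv.addRight (r₀ s)).bijective]
    rw [PMF.map_comp, PMF.map_comp]
    congr 1
    funext r
    exact congrArg (Prod.mk s) (hr₀ s r)
  rw [this]
  exact mutualInformation_bind_map_mk _ _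

end StorageScheme

/-! ### Linearized polynomials -/

section Linearized

open Polynomial

variable {B F : Type*} [Field B] [Fintype B] [Field F]

theorem coeff_linearizedPoly {K : ℕ} (a : Fin K → F) (i : Fin K) :
    (linearizedPoly (Fintype.card B) a).coeff (Fintype.card B ^ (i : ℕ)) = a i := by
  rw [linearizedPoly, finsetSum_coeff, Finset.sum_eq_single i]
  · simp
  · intro j _ hj
    rw [coeff_C_mul, coeff_X_pow, if_neg, mul_zero]
    intro h
    exact hj (Fin.ext (Nat.pow_right_injective Fintype.one_lt_card h.symm))
  · simp

theorem degree_linearizedPoly_lt {K : ℕ} (a : Fin K → F) :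
    (linearizedPoly (Fintype.card B) a).degree < ((Fintype.card B ^ K : ℕ) : WithBot ℕ) := by
  refine (degree_sum_le _ _).trans_lt ?_
  rw [Finset.sup_lt_iff (WithBot.bot_lt_coe _)]
  intro i _
  refine (degree_C_mul_X_pow_le _ _).trans_lt ?_
  exact_mod_cast Nat.pow_lt_pow_right Fintype.one_lt_card i.2

variable [Algebra B F]

variable (B) in
/-- The evaluation of a linearized polynomial as a linear map. -/
def linearizedEval {K : ℕ} (a : Fin K → F) : F →ₗ[B] F :=
  ∑ i : Fin K, LinearMap.mulLeft B (a i) ∘ₗ ((FiniteField.frobeniusAlgHom B F) ^ (i : ℕ)).toLinearMap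

theorem linearizedEval_apply {K : ℕ} (a : Fin K → F) (x : F) :
    linearizedEval B a x = ∑ i, a i * x ^ (Fintype.card B ^ (i : ℕ)) := by
  simp [linearizedEval, LinearMap.sum_apply, AlgHom.coe_pow, FiniteField.coe_frobeniusAlgHom,
    pow_iterate]

theorem eval_linearizedPoly {K : ℕ} (a : Fin K → F) (x : F) :
    (linearizedPoly (Fintype.card B) a).eval x = linearizedEval B a x := by
  simp [linearizedPoly, linearizedEval_apply, eval_finsetSum]

theorem linearizedEval_add {K : ℕ} (a b : Fin K → F) (x : F) :
    linearizedEval B (a + b) x = linearizedEval B a x + linearizedEval B b x := by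
  simp [linearizedEval_apply, add_mul, Finset.sum_add_distrib]

theorem linearizedEval_smul {K : ℕ} (t : F) (a : Fin K → F) (x : F) :
    linearizedEval B (t • a) x = t * linearizedEval B a x := by
  simp [linearizedEval_apply, mul_assoc, Finset.mul_sum]

/-- The polynomial has degree below `q ^ K`, with `q = |B|`, but by linearity it vanishes at all `q
^ |ι|` combinations of the points `z`. -/
theorem eq_zero_of_linearizedEval_eq_zero {ι : Type*} [Fintype ι] {K : ℕ} (hK : K ≤ Fintype.card ι)
    {z : ι → F} (hz : LinearIndependent B z) {a : Fin K → F}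
    (h : ∀ l, linearizedEval B a (z l) = 0) : a = 0 := by
  have hpoly : linearizedPoly (Fintype.card B) a = 0 := by
    classical
    let e : (ι → B) ↪ F := ⟨Fintype.linearCombination B z, hz.fintypeLinearCombination_injective⟩
    refine Polynomial.eq_zero_of_degree_lt_of_eval_finset_eq_zero (Finset.univ.map e) ?_ ?_
    · refine (degree_linearizedPoly_lt a).trans_le ?_
      rw [Finset.card_map, Finset.card_univ, Fintype.card_fun]
      exact_mod_cast Nat.pow_le_pow_right Fintype.card_pos hK
    · intro x hx
      obtain ⟨w, -, rfl⟩ := Finset.mem_map.1 hx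
      rw [eval_linearizedPoly]
      simp [e, Fintype.linearCombination_apply, map_sum, h]
  funext i
  rw [← coeff_linearizedPoly (B := B) a i, hpoly, coeff_zero, Pi.zero_apply]

theorem exists_linearizedEval_eq {ι : Type*} [Fintype ι] {z : ι → F} (hz : LinearIndependent B z)
    {m : ℕ} (hm : Fintype.card ι = m) (t : ι → F) :
    ∃ a : Fin m → F, ∀ l, linearizedEval B a (z l) = t l := by
  let f : (Fin m → F) →ₗ[F] (ι → F) :=
    { toFun := fun a l => linearizedEval B a (z l)
      map_add' := fun a b => funext fun l => linearizedEval_add a b (z l)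
      map_smul' := fun t a => funext fun l => linearizedEval_smul t a (z l) }
  have hinj : Function.Injective f := by
    rw [← LinearMap.ker_eq_bot, LinearMap.ker_eq_bot']
    intro a ha
    exact eq_zero_of_linearizedEval_eq_zero hm.ge hz fun l => congrFun ha l
  obtain ⟨a, ha⟩ := (LinearMap.injective_iff_surjective_of_finrank_eq_finrank (f := f)
    (by simp [hm])).1 hinj t
  exact ⟨a, fun l => congrFun ha l⟩

theorem randomThenFile_add {K Ms : ℕ} (s s' : Fin Ms → F) (r r' : Fin (K - Ms) → F) :
    randomThenFile (K := K) (s + s') (r + r') = randomThenFile s r + randomThenFile s' r' := by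
  funext i
  by_cases h : i.val < K - Ms <;> simp [randomThenFile, h]

theorem linearizedEval_castLE {m K : ℕ} (h : m ≤ K) (a : Fin m → F) (b : Fin K → F)
    (hb : ∀ i : Fin K, b i = if hi : i.val < m then a ⟨i, hi⟩ else 0) (x : F) :
    linearizedEval B b x = linearizedEval B a x := by
  obtain ⟨d, rfl⟩ := Nat.exists_eq_add_of_le h
  rw [linearizedEval_apply, linearizedEval_apply, Fin.sum_univ_add]
  simp [hb]

/-- The random symbols are the lowest `K - Ms` coefficients, enough to interpolate any `B`-linear
map on a space of at most that dimension. -/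
theorem exists_linearizedEval_randomThenFile_eq {K Ms : ℕ} {Z : Submodule B F}
    [FiniteDimensional B Z] (hZ : Module.finrank B Z ≤ K - Ms) (g : F →ₗ[B] F) :
    ∃ r : Fin (K - Ms) → F,
      ∀ x ∈ Z, linearizedEval B (randomThenFile (K := K) (0 : Fin Ms → F) r) x = g x := by
  let b := Module.finBasis B Z
  have hb : LinearIndependent B (fun l => (b l : F)) := b.linearIndependent.map' Z.subtype (by simp)
  obtain ⟨a, ha⟩ := exists_linearizedEval_eq hb (Fintype.card_fin _) fun l => g (b l)
  let r : Fin (K - Ms) → F :=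
    fun i => if hi : i.val < Module.finrank B Z then a ⟨i, hi⟩ else 0
  refine ⟨r, fun x hx => ?_⟩
  rw [linearizedEval_castLE (hZ.trans (Nat.sub_le _ _)) a]
  · have h : (linearizedEval B a).comp Z.subtype = g.comp Z.subtype :=
      b.ext fun l => ha l
    exact LinearMap.congr_fun h ⟨x, hx⟩
  · intro i
    by_cases hi : i.val < K - Ms
    · simp [randomThenFile, hi, r]
    · have : ¬ i.val < Module.finrank B Z := fun h => hi (h.trans_le hZ)
      simp [randomThenFile, hi, this]

end Linearized

/-! ### Block Vandermonde systems -/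

/-- Gaussian elimination: subtracting `A l` times equation `t` from equation `t + 1` removes node
`l` and leaves the same system, one equation shorter, in the unknowns `(A j - A l) x j`. -/
theorem eq_zero_of_sum_pow_mulVec_eq_zero {ι m R : Type*} [CommRing R] [Fintype m] [DecidableEq m]
    {A : ι → Matrix m m R} (hA : ∀ i j, Commute (A i) (A j))
    (hinj : ∀ i j, i ≠ j → ∀ x : m → R, (A i - A j).mulVec x = 0 → x = 0)
    (s : Finset ι) : ∀ x : ι → m → R,
      (∀ t < s.card, ∑ j ∈ s, (A j ^ t).mulVec (x j) = 0) → ∀ j ∈ s, x j = 0 := by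
  classical
  induction s using Finset.induction_on with
  | empty => simp
  | insert l s hl ih =>
    intro x hx
    rw [Finset.card_insert_of_notMem hl] at hx
    have hs : ∀ j ∈ s, x j = 0 := by
      intro j hj
      refine hinj j l (ne_of_mem_of_not_mem hj hl) _
        (ih (fun j => (A j - A l).mulVec (x j)) (fun t ht => ?_) j hj)
      have h1 := hx (t + 1) (Nat.succ_lt_succ ht)
      have h2 := congrArg (A l).mulVec (hx t (ht.trans (Nat.lt_succ_self _)))
      rw [Matrix.mulVec_zero, Matrix.mulVec_sum] at h2
      rw [← sub_zero (0 : m → R)]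
      nth_rewrite 1 [← h1]
      rw [← h2, ← Finset.sum_sub_distrib, Finset.sum_insert hl]
      have h3 : (A l ^ (t + 1)).mulVec (x l) - (A l).mulVec ((A l ^ t).mulVec (x l)) = 0 := by
        rw [Matrix.mulVec_mulVec, pow_succ', sub_self]
      rw [h3, zero_add]
      refine Finset.sum_congr rfl fun i _ => ?_
      rw [Matrix.mulVec_mulVec, Matrix.mulVec_mulVec, mul_sub, ← pow_succ,
        ((hA i l).pow_left t).eq, Matrix.sub_mulVec]
    intro j hj
    rcases Finset.mem_insert.1 hj with rfl | hj
    · have h0 := hx 0 (Nat.succ_pos _)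
      rw [Finset.sum_insert hl, Finset.sum_eq_zero] at h0
      · simpa using h0
      · intro i hi
        rw [hs i hi, Matrix.mulVec_zero]
    · exact hs j hj

namespace YeBarg

variable {n k : ℕ} {B : Type*} [Field B] {γ : B}

/-! ### Powers of the block matrices -/

/-- The digit `u ⊕ t`. -/
def shift {r : ℕ} (u : Fin r) (t : ℕ) : Fin r := ⟨(u.val + t) % r, Nat.mod_lt _ u.pos⟩

theorem shift_zero {r : ℕ} (u : Fin r) : shift u 0 = u :=
  Fin.ext (Nat.mod_eq_of_lt u.2)

theorem shift_self {r : ℕ} (u : Fin r) : shift u r = u :=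
  Fin.ext ((Nat.add_mod_right _ _).trans (Nat.mod_eq_of_lt u.2))

theorem next_shift {r : ℕ} (u : Fin r) (t : ℕ) : shift (next u) t = shift u (t + 1) :=
  Fin.ext (by simp [shift, next, Nat.add_assoc, Nat.add_comm 1 t])

theorem coeff_ne_zero (hγ : γ ≠ 0) {m r : ℕ} (i : Fin m) (u : Fin r) : coeff γ i u ≠ 0 := by
  unfold coeff
  split_ifs
  · exact pow_ne_zero _ hγ
  · exact one_ne_zero

theorem blockMatrix_mulVec {v : Fin n} (h : v.val < n - 1) (x : Digits n k → B)
    (a : Digits n k) :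
    (blockMatrix n k γ v).mulVec x a =
      coeff γ (⟨v, h⟩ : Fin (n - 1)) (a ⟨v, h⟩) *
        x (Function.update a ⟨v, h⟩ (next (a ⟨v, h⟩))) := by
  simp [blockMatrix, h, Matrix.mulVec, dotProduct]

theorem blockMatrix_of_not_lt {v : Fin n} (h : ¬ v.val < n - 1) : blockMatrix n k γ v = 1 := by
  simp [blockMatrix, h]

theorem blockMatrix_pow_mulVec {v : Fin n} (h : v.val < n - 1) (t : ℕ) (x : Digits n k → B) :
    ∀ a : Digits n k, (blockMatrix n k γ v ^ t).mulVec x a =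
      (∏ s ∈ Finset.range t, coeff γ (⟨v, h⟩ : Fin (n - 1)) (shift (a ⟨v, h⟩) s)) *
        x (Function.update a ⟨v, h⟩ (shift (a ⟨v, h⟩) t)) := by
  induction t with
  | zero => intro a; simp [shift_zero]
  | succ t ih =>
    intro a
    rw [pow_succ', ← Matrix.mulVec_mulVec, blockMatrix_mulVec h, ih]
    simp only [Function.update_self, Function.update_idem, next_shift]
    rw [Finset.prod_range_succ', shift_zero]
    ring

theorem commute_blockMatrix (v w : Fin n) :
    Commute (blockMatrix n k γ v) (blockMatrix n k γ w) := by
  rcases eq_or_ne v w with rfl | hvw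
  · exact Commute.refl _
  by_cases hv : v.val < n - 1
  swap
  · rw [blockMatrix_of_not_lt hv]
    exact Commute.one_left _
  by_cases hw : w.val < n - 1
  swap
  · rw [blockMatrix_of_not_lt hw]
    exact Commute.one_right _
  have hne : (⟨v, hv⟩ : Fin (n - 1)) ≠ ⟨w, hw⟩ := fun h => hvw (Fin.ext (Fin.mk.inj_iff.1 h))
  refine Matrix.ext_of_mulVec_single fun b => ?_
  funext a
  rw [← Matrix.mulVec_mulVec, ← Matrix.mulVec_mulVec, blockMatrix_mulVec hv,
    blockMatrix_mulVec hw, blockMatrix_mulVec hw, blockMatrix_mulVec hv,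
    Function.update_of_ne hne, Function.update_of_ne hne.symm, Function.update_comm hne]
  ring

/-- Exactly one of the `r` successive shifts of `u` is the digit `0`. -/
theorem prod_coeff_shift {m r : ℕ} (i : Fin m) (u : Fin r) :
    ∏ s ∈ Finset.range r, coeff γ i (shift u s) = γ ^ (i.val + 1) := by
  have hr := u.pos
  have h0 : (u.val + (r - u.val) % r) % r = 0 := by
    rw [Nat.add_mod_mod, Nat.add_sub_cancel' u.2.le, Nat.mod_self]
  rw [Finset.prod_eq_single ((r - u.val) % r)]
  · rw [coeff, if_pos]
    exact h0
  · intro s hs hne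
    rw [coeff, if_neg]
    intro hs0
    apply hne
    have h : u.val + s ≡ u.val + (r - u.val) % r [MOD r] := Eq.trans hs0 h0.symm
    have := Nat.ModEq.add_left_cancel' _ h
    rwa [Nat.ModEq, Nat.mod_eq_of_lt (Finset.mem_range.1 hs), Nat.mod_mod] at this
  · intro h
    exact absurd (Finset.mem_range.2 (Nat.mod_lt _ hr)) h

theorem blockMatrix_pow_sub (v : Fin n) :
    blockMatrix n k γ v ^ (n - k) = γ ^ (if v.val < n - 1 then v.val + 1 else 0) • 1 := by
  by_cases hv : v.val < n - 1
  · refine Matrix.ext_of_mulVec_single fun b => ?_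
    funext a
    rw [blockMatrix_pow_mulVec hv, prod_coeff_shift, shift_self, Function.update_eq_self, if_pos hv,
      Matrix.smul_mulVec, Matrix.one_mulVec, Pi.smul_apply, smul_eq_mul]
  · rw [blockMatrix_of_not_lt hv, one_pow, if_neg hv, pow_zero, one_smul]

/-- Since the matrices commute, all their powers agree on `x`. The `(n - k)`-th powers are scalars
`γ ^ e` with distinct exponents in `0, …, n - 1` (`0` for the last node), which `n ≤ q` keeps
distinct. -/
theorem eq_zero_of_blockMatrix_sub_mulVec_eq_zero {q : ℕ} (hγ : IsPrimitiveRoot γ q) (hq : n ≤ q)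
    {v w : Fin n} (hvw : v ≠ w) (x : Digits n k → B)
    (hx : (blockMatrix n k γ v - blockMatrix n k γ w).mulVec x = 0) : x = 0 := by
  rw [Matrix.sub_mulVec, sub_eq_zero] at hx
  have hpow : ∀ t : ℕ, (blockMatrix n k γ v ^ t).mulVec x = (blockMatrix n k γ w ^ t).mulVec x := by
    intro t
    induction t with
    | zero => simp
    | succ t ih =>
      rw [pow_succ, ← Matrix.mulVec_mulVec, hx, Matrix.mulVec_mulVec,
        ((commute_blockMatrix v w).pow_left t).eq, ← Matrix.mulVec_mulVec, ih,
        Matrix.mulVec_mulVec, ← pow_succ']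
  have h := hpow (n - k)
  rw [blockMatrix_pow_sub, blockMatrix_pow_sub, Matrix.smul_mulVec, Matrix.smul_mulVec,
    Matrix.one_mulVec, ← sub_eq_zero, ← sub_smul] at h
  refine (smul_eq_zero.1 h).resolve_left fun h0 => hvw ?_
  have hv := v.2
  have hw := w.2
  have := hγ.pow_inj (by split_ifs <;> omega) (by split_ifs <;> omega) (sub_eq_zero.1 h0)
  refine Fin.ext ?_
  split_ifs at this <;> omega

/-! ### The MDS and repair properties -/

theorem mem_code_iff {c : Fin n × Digits n k → B} :
    c ∈ code n k γ ↔ ∀ t < n - k,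
      ∑ v, (blockMatrix n k γ v ^ t).mulVec (fun a => c (v, a)) = 0 := by
  rw [code, LinearMap.mem_ker, Matrix.mulVecLin_apply]
  have key : ∀ (t : Fin (n - k)) (a : Digits n k), (parityCheck n k γ).mulVec c (t, a) =
      (∑ v, (blockMatrix n k γ v ^ (t : ℕ)).mulVec (fun a => c (v, a))) a := by
    intro t a
    rw [Finset.sum_apply, Matrix.mulVec, dotProduct, Fintype.sum_prod_type]
    rfl
  constructor
  · intro h t ht
    funext a
    rw [← key ⟨t, ht⟩ a, h]
    rfl
  · intro h
    funext x
    rw [← Prod.mk.eta (p := x), key, h _ x.1.2]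
    rfl

theorem eq_zero_of_mem_code {q : ℕ} (hγ : IsPrimitiveRoot γ q) (hq : n ≤ q)
    {K : Finset (Fin n)} (hK : K.card = k) {c : Fin n × Digits n k → B} (hc : c ∈ code n k γ)
    (h : ∀ v ∈ K, ∀ a, c (v, a) = 0) : c = 0 := by
  have hcard : Kᶜ.card = n - k := by rw [Finset.card_compl, Fintype.card_fin, hK]
  have hcompl := eq_zero_of_sum_pow_mulVec_eq_zero (A := blockMatrix n k γ) commute_blockMatrix
    (fun v w hvw => eq_zero_of_blockMatrix_sub_mulVec_eq_zero hγ hq hvw) Kᶜ (fun v a => c (v, a))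
    (fun t ht => by
      rw [← mem_code_iff.1 hc t (hcard ▸ ht), ← Finset.sum_add_sum_compl K, right_eq_add]
      refine Finset.sum_eq_zero fun v hv => ?_
      have : (fun a => c (v, a)) = 0 := funext fun a => h v hv a
      rw [this, Matrix.mulVec_zero])
  funext x
  by_cases hx : x.1 ∈ K
  · exact h x.1 hx x.2
  · exact congrFun (hcompl x.1 (Finset.mem_compl.2 hx)) x.2

theorem sum_update_shift_mod {m r : ℕ} (a : Fin m → Fin r) (j : Fin m) (t : ℕ) :
    (∑ i, (Function.update a j (shift (a j) t) i).val) % r = ((∑ i, (a i).val) + t) % r := by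
  classical
  rw [← Finset.add_sum_erase _ _ (Finset.mem_univ j), Function.update_self,
    ← Finset.add_sum_erase _ (fun i => (a i).val) (Finset.mem_univ j),
    Finset.sum_congr rfl fun i hi => by rw [Function.update_of_ne (Finset.ne_of_mem_erase hi)]]
  simp only [shift, Nat.mod_add_mod]
  congr 1
  ring

theorem eq_zero_of_accessed_eq_zero (hkn : k < n) (hγ : γ ≠ 0) {c : Fin n × Digits n k → B}
    (hc : c ∈ code n k γ) {v : Fin n}
    (h : ∀ w, w ≠ v → ∀ a, IsAccessed n k v a → c (w, a) = 0) (b : Digits n k) :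
    c (v, b) = 0 := by
  have hn := v.2
  by_cases hv : v.val < n - 1
  · have hpos := (b ⟨v, hv⟩).pos
    -- In row `a` of block row `t = b_v`, node `v` contributes a nonzero multiple of coordinate `b`.
    -- Every other node contributes a coordinate whose digit `v` is still `0`, hence an accessed
    -- one.
    let a : Digits n k := Function.update b ⟨v, hv⟩ ⟨0, hpos⟩
    have hrow := congrFun (mem_code_iff.1 hc (b ⟨v, hv⟩) (b ⟨v, hv⟩).2) a
    rw [Finset.sum_apply, Finset.sum_eq_single v, blockMatrix_pow_mulVec hv, Pi.zero_apply] at hrow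
    · have hb : Function.update a ⟨v, hv⟩ (shift (a ⟨v, hv⟩) (b ⟨v, hv⟩)) = b := by
        have : shift (a ⟨v, hv⟩) (b ⟨v, hv⟩) = b ⟨v, hv⟩ := by
          refine Fin.ext ?_
          simp [shift, a, Nat.mod_eq_of_lt (b ⟨v, hv⟩).2]
        rw [this, Function.update_idem, Function.update_eq_self]
      rw [hb] at hrow
      exact (mul_eq_zero.1 hrow).resolve_left
        (Finset.prod_ne_zero_iff.2 fun s _ => coeff_ne_zero hγ _ _)
    · intro w _ hwv
      by_cases hw : w.val < n - 1
      · rw [blockMatrix_pow_mulVec hw, h w hwv, mul_zero]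
        have hne : (⟨v, hv⟩ : Fin (n - 1)) ≠ ⟨w, hw⟩ :=
          fun h => hwv (Fin.ext (Fin.mk.inj_iff.1 h).symm)
        simp [IsAccessed, hv, Function.update_of_ne hne, a]
      · rw [blockMatrix_of_not_lt hw, one_pow, Matrix.one_mulVec, h w hwv]
        simp [IsAccessed, hv, a]
    · exact fun h => absurd (Finset.mem_univ v) h
  · have hpos : 0 < n - k := Nat.sub_pos_of_lt hkn
    let m := ∑ i, (b i).val
    -- Shifting any single digit of `b` by this `t` makes the digit sum vanish modulo `n - k`, so
    -- every other node contributes an accessed coordinate.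
    let t := (n - k - m % (n - k)) % (n - k)
    have ht : (m + t) % (n - k) = 0 := by
      rw [Nat.add_mod_mod, ← Nat.mod_add_mod, Nat.add_sub_cancel' (Nat.mod_lt _ hpos).le,
        Nat.mod_self]
    have hrow := congrFun (mem_code_iff.1 hc t (Nat.mod_lt _ hpos)) b
    rw [Finset.sum_apply, Finset.sum_eq_single v, blockMatrix_of_not_lt hv, one_pow,
      Matrix.one_mulVec] at hrow
    · exact hrow
    · intro w _ hwv
      have hw : w.val < n - 1 := by
        have := w.2
        have := fun h => hwv (Fin.ext h)
        omega
      rw [blockMatrix_pow_mulVec hw, h w hwv, mul_zero]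
      simp only [IsAccessed, hv, dif_neg, not_false_eq_true]
      rw [sum_update_shift_mod, ht]
    · exact fun h => absurd (Finset.mem_univ v) h

/-! ### Counting accessed coordinates -/

theorem card_forall_ne_zero {m r : ℕ} (A : Finset (Fin m)) :
    Nat.card {a : Fin m → Fin r // ∀ i ∈ A, (a i).val ≠ 0} =
      (r - 1) ^ A.card * r ^ (m - A.card) := by
  classical
  have hset : (Finset.univ.filter fun a : Fin m → Fin r => ∀ i ∈ A, (a i).val ≠ 0) =
      Fintype.piFinset fun i =>
        if i ∈ A then Finset.univ.filter (fun u : Fin r => u.val ≠ 0) else Finset.univ := by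
    ext a
    simp only [Finset.mem_filter, Finset.mem_univ, true_and, Fintype.mem_piFinset]
    refine forall_congr' fun i => ?_
    by_cases hi : i ∈ A
    · simp only [hi, if_true, Finset.mem_filter, Finset.mem_univ, true_and, forall_const]
    · simp only [hi, if_false, Finset.mem_univ, false_imp_iff]
  have hnz : (Finset.univ.filter (fun u : Fin r => u.val ≠ 0)).card = r - 1 := by
    rcases r with _ | r
    · simp
    · have : (Finset.univ.filter (fun u : Fin (r + 1) => u.val ≠ 0)) = Finset.univ.erase 0 := by
        ext u
        rw [Finset.mem_filter, Finset.mem_erase, ne_eq, ne_eq, Fin.ext_iff, and_comm, Fin.val_zero]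
      rw [this, Finset.card_erase_of_mem (Finset.mem_univ _), Finset.card_univ, Fintype.card_fin]
  rw [Nat.card_eq_fintype_card, Fintype.card_subtype, hset, Fintype.card_piFinset]
  rw [Finset.prod_congr rfl fun i _ => apply_ite Finset.card _ _ _, hnz, Finset.card_univ,
    Fintype.card_fin,
    Finset.prod_ite, Finset.prod_const, Finset.prod_const, Finset.filter_mem_eq_inter,
    Finset.univ_inter, Finset.filter_notMem_eq_sdiff, ← Finset.compl_eq_univ_sdiff,
    Finset.card_compl, Fintype.card_fin]

/-- Replacing a digit by the sum of all digits. -/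
theorem bijective_update_sum {m r : ℕ} (hr : 0 < r) (j : Fin m) :
    Function.Bijective fun a : Fin m → Fin r =>
      Function.update a j ⟨(∑ i, (a i).val) % r, Nat.mod_lt _ hr⟩ := by
  classical
  rw [← Finite.injective_iff_bijective]
  intro a b hab
  have hne : ∀ i, i ≠ j → a i = b i := by
    intro i hi
    have := congrFun hab i
    simpa [Function.update_of_ne hi] using this
  have hsum : (∑ i, (a i).val) ≡ (∑ i, (b i).val) [MOD r] := by
    have := congrFun hab j
    simpa [Fin.ext_iff, Nat.ModEq] using this
  rw [← Finset.add_sum_erase _ _ (Finset.mem_univ j),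
    ← Finset.add_sum_erase _ (fun i => (b i).val) (Finset.mem_univ j),
    Finset.sum_congr rfl fun i hi => by rw [hne i (Finset.ne_of_mem_erase hi)]] at hsum
  have hj := Nat.ModEq.add_right_cancel' _ hsum
  rw [Nat.ModEq, Nat.mod_eq_of_lt (a j).2, Nat.mod_eq_of_lt (b j).2] at hj
  funext i
  rcases eq_or_ne i j with rfl | hi
  · exact Fin.ext hj
  · exact hne i hi

/-- The number of coordinates that are not accessed for the repair of any node in `A`. -/
theorem card_forall_not_isAccessed (hkn : k < n) {A : Finset (Fin n)} (hA : A.card ≤ n - 1) :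
    Nat.card {a : Digits n k // ∀ v ∈ A, ¬ IsAccessed n k v a} =
      (n - k - 1) ^ A.card * (n - k) ^ (n - 1 - A.card) := by
  classical
  let e : Fin (n - 1) ↪ Fin n := Fin.castLEEmb (Nat.sub_le n 1)
  let A' : Finset (Fin (n - 1)) := Finset.univ.filter fun i => e i ∈ A
  have hA' : A'.map e = A.filter fun v => v.val < n - 1 := by
    ext v
    simp only [Finset.mem_map, Finset.mem_filter, Finset.mem_univ, true_and, A']
    constructor
    · rintro ⟨i, hi, rfl⟩
      exact ⟨hi, i.2⟩
    · rintro ⟨hv, hlt⟩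
      exact ⟨⟨v, hlt⟩, hv, rfl⟩
  have hacc : ∀ (v : Fin n) (h : v.val < n - 1) (a : Digits n k),
      ¬ IsAccessed n k v a ↔ (a ⟨v, h⟩).val ≠ 0 := by
    intro v h a
    simp [IsAccessed, h]
  by_cases hlast : ∀ v ∈ A, v.val < n - 1
  · rw [Finset.filter_true_of_mem hlast] at hA'
    have hcard : A'.card = A.card := by rw [← hA', Finset.card_map]
    rw [← hcard, ← card_forall_ne_zero]
    refine Nat.card_congr (Equiv.subtypeEquivRight fun a => ?_)
    constructor
    · intro h i hi
      exact (hacc (e i) i.2 a).1 (h _ (Finset.mem_filter.1 hi).2)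
    · intro h v hv
      exact (hacc v (hlast v hv) a).2 (h _ (Finset.mem_filter.2 ⟨Finset.mem_univ _, hv⟩))
  · push Not at hlast
    obtain ⟨l, hl, hln⟩ := hlast
    have hfilter : (A.filter fun v => v.val < n - 1) = A.erase l := by
      ext v
      have := v.2
      have := l.2
      simp only [Finset.mem_filter, Finset.mem_erase, ne_eq, Fin.ext_iff]
      constructor
      · rintro ⟨hv, h⟩
        exact ⟨by omega, hv⟩
      · rintro ⟨h, hv⟩
        exact ⟨hv, by omega⟩
    have hcard : A'.card + 1 = A.card := by
      rw [← Finset.card_map e, hA', hfilter, Finset.card_erase_add_one hl]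
    -- The last node is in `A`, so some digit `j` is unconstrained; replacing it by the digit sum
    -- turns the condition of the last node into an ordinary one on digit `j`.
    obtain ⟨j, hj⟩ : ∃ j, j ∉ A' := by
      by_contra! hall
      have := Finset.card_le_card (fun j _ => hall j : (Finset.univ : Finset (Fin (n - 1))) ⊆ A')
      rw [Finset.card_univ, Fintype.card_fin] at this
      omega
    have hr : 0 < n - k := Nat.sub_pos_of_lt hkn
    rw [← hcard, ← Finset.card_insert_of_notMem hj, ← card_forall_ne_zero]
    refine Nat.card_congr ((Equiv.ofBijective _ (bijective_update_sum hr j)).subtypeEquiv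
      fun a => ?_)
    have hlacc : ¬ IsAccessed n k l a ↔ (∑ i, (a i).val) % (n - k) ≠ 0 := by
      simp [IsAccessed, hln.not_gt]
    simp only [Equiv.ofBijective_apply, Finset.forall_mem_insert, Function.update_self]
    constructor
    · intro h
      refine ⟨hlacc.1 (h l hl), fun i hi => ?_⟩
      rw [Function.update_of_ne (ne_of_mem_of_not_mem hi hj)]
      exact (hacc (e i) i.2 a).1 (h _ (Finset.mem_filter.1 hi).2)
    · rintro ⟨h0, h⟩ v hv
      by_cases hvn : v.val < n - 1
      · have hvA : (⟨v, hvn⟩ : Fin (n - 1)) ∈ A' := Finset.mem_filter.2 ⟨Finset.mem_univ _, hv⟩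
        have := h _ hvA
        rw [Function.update_of_ne (ne_of_mem_of_not_mem hvA hj)] at this
        exact (hacc v hvn a).2 this
      · have : v = l := by
          have := v.2
          have := l.2
          exact Fin.ext (by omega)
        rw [this]
        exact hlacc.2 h0

theorem card_isAccessed (hkn : k < n) (hn : 2 ≤ n) (v : Fin n) :
    (n - k) * Nat.card {a : Digits n k // IsAccessed n k v a} = Nat.card (Digits n k) := by
  classical
  have h := card_forall_not_isAccessed (k := k) hkn (A := {v}) (by rw [Finset.card_singleton]; omega)
  simp only [Finset.mem_singleton, forall_eq, Finset.card_singleton, pow_one] at h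
  rw [Nat.card_eq_fintype_card, Fintype.card_subtype_compl] at h
  have hle := Fintype.card_subtype_le (IsAccessed n k v)
  have htot : Fintype.card (Digits n k) = (n - k) ^ (n - 1 - 1) * (n - k) := by
    rw [Fintype.card_fun, Fintype.card_fin, Fintype.card_fin, ← pow_succ]
    congr 1
    omega
  rw [Nat.card_eq_fintype_card, Nat.card_eq_fintype_card]
  have hpos : 1 ≤ n - k := Nat.sub_pos_of_lt hkn
  have : Fintype.card {a : Digits n k // IsAccessed n k v a} = (n - k) ^ (n - 1 - 1) := by
    generalize (n - k) ^ (n - 1 - 1) = P at h htot ⊢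
    zify [hle, hpos] at h htot ⊢
    linarith
  rw [this, htot, mul_comm]

/-! ### The dimension of the code -/

/-- Restriction to `k` nodes is injective, which bounds the dimension above; the number of rows of
the parity check bounds it below. -/
theorem finrank_code (hkn : k < n) {q : ℕ} (hγ : IsPrimitiveRoot γ q) (hq : n ≤ q) :
    Module.finrank B (code n k γ) = k * (n - k) ^ (n - 1) := by
  have hcard : Fintype.card (Digits n k) = (n - k) ^ (n - 1) := by simp
  refine le_antisymm ?_ ?_
  · obtain ⟨K, -, hK⟩ := Finset.exists_subset_card_eq
      (s := (Finset.univ : Finset (Fin n))) (n := k) (by simpa using hkn.le)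
    let f : code n k γ →ₗ[B] (K × Digits n k → B) :=
      (LinearMap.funLeft B B fun x : K × Digits n k => ((x.1 : Fin n), x.2)).comp
        (code n k γ).subtype
    have hf : Function.Injective f := by
      rw [← LinearMap.ker_eq_bot, LinearMap.ker_eq_bot']
      intro c hc
      exact Subtype.ext (eq_zero_of_mem_code hγ hq hK c.2 fun v hv a =>
        congrFun hc (⟨v, hv⟩, a))
    have := LinearMap.finrank_le_finrank_of_injective hf
    rwa [Module.finrank_fintype_fun_eq_card, Fintype.card_prod, Fintype.card_coe, hK, hcard] at this
  · have h := (parityCheck n k γ).mulVecLin.finrank_range_add_finrank_ker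
    have hle := Submodule.finrank_le (LinearMap.range (parityCheck n k γ).mulVecLin)
    rw [Module.finrank_fintype_fun_eq_card, Fintype.card_prod, Fintype.card_fin, hcard] at h hle
    change _ ≤ Module.finrank B (LinearMap.ker (parityCheck n k γ).mulVecLin)
    obtain ⟨r, hr⟩ : ∃ r, n = k + r := ⟨n - k, by omega⟩
    have : n * (n - k) ^ (n - 1) = k * (n - k) ^ (n - 1) + (n - k) * (n - k) ^ (n - 1) := by
      rw [← add_mul]
      congr 1
      omega
    omega

theorem exists_isGeneratorMatrix (hkn : k < n) {q : ℕ} (hγ : IsPrimitiveRoot γ q) (hq : n ≤ q) :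
    ∃ G, IsGeneratorMatrix n k γ G := by
  let b := Module.finBasisOfFinrankEq B (code n k γ) (finrank_code hkn hγ hq)
  refine ⟨Matrix.of fun i => (b i : Fin n × Digits n k → B), ?_, ?_⟩
  · exact b.linearIndependent.map' (code n k γ).subtype (by simp)
  · have := congrArg (Submodule.map (code n k γ).subtype) b.span_eq
    rw [Submodule.map_span, ← Set.range_comp, Submodule.map_subtype_top] at this
    exact this

theorem exists_mem_code_eqOn (hkn : k < n) {q : ℕ} (hγ : IsPrimitiveRoot γ q) (hq : n ≤ q)
    {K : Finset (Fin n)} (hK : K.card = k) (x : Fin n → Digits n k → B) :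
    ∃ c ∈ code n k γ, ∀ v ∈ K, ∀ a, c (v, a) = x v a := by
  let f : code n k γ →ₗ[B] (K × Digits n k → B) :=
    (LinearMap.funLeft B B fun x : K × Digits n k => ((x.1 : Fin n), x.2)).comp
      (code n k γ).subtype
  have hf : Function.Injective f := by
    rw [← LinearMap.ker_eq_bot, LinearMap.ker_eq_bot']
    intro c hc
    exact Subtype.ext (eq_zero_of_mem_code hγ hq hK c.2 fun v hv a => congrFun hc (⟨v, hv⟩, a))
  have hsurj := (LinearMap.injective_iff_surjective_of_finrank_eq_finrank (f := f) (by
    rw [finrank_code hkn hγ hq, Module.finrank_fintype_fun_eq_card, Fintype.card_prod,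
      Fintype.card_coe, hK]
    simp)).1 hf
  obtain ⟨c, hc⟩ := hsurj fun y => x y.1 y.2
  exact ⟨c, c.2, fun v hv a => congrFun hc (⟨v, hv⟩, a)⟩

/-- Stated for any field with a suitable root of unity: it is applied over `F` to the scheme and
over `B` for alignment inside the code. -/
theorem isMSRCode (hkn : k < n) (hn : 2 ≤ n) {q : ℕ} (hγ : IsPrimitiveRoot γ q)
    (hq : n ≤ q) :
    IsMSRCode {c : Fin n → Digits n k → B | (fun x : Fin n × Digits n k => c x.1 x.2) ∈ code n k γ}
      (fun i _ => LinearMap.funLeft B B (Subtype.val : {a // IsAccessed n k i a} → Digits n k))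
      k where
  exists_eqOn K hK x := by
    obtain ⟨c, hc, hcx⟩ := exists_mem_code_eqOn hkn hγ hq hK x
    exact ⟨fun v a => c (v, a), hc, fun v hv => funext fun a => hcx v hv a⟩
  eq_of_eqOn K hK c hc c' hc' h := by
    have := eq_zero_of_mem_code hγ hq hK ((code n k γ).sub_mem hc hc') fun v hv a =>
      sub_eq_zero.2 (congrFun (h v hv) a)
    funext v a
    exact sub_eq_zero.1 (congrFun this (v, a))
  repair i c hc c' hc' h := by
    funext a
    refine sub_eq_zero.1 (eq_zero_of_accessed_eq_zero hkn (hγ.ne_zero (by omega))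
      ((code n k γ).sub_mem hc hc') (v := i) (fun w hw a ha => ?_) a)
    exact sub_eq_zero.2 (congrFun (h w hw) ⟨a, ha⟩)
  card_eq i := by
    rw [Nat.card_fun (α := Digits n k), Nat.card_fun (α := {a // IsAccessed n k i a}), ← pow_mul, mul_comm, card_isAccessed hkn hn]

end YeBarg

/-! ### The upper bound on the secrecy capacity -/

namespace StorageScheme

variable {F : Type*} [Field F] [Fintype F] {n k : ℕ} {N : Type} [Finite N] {Ms Mr : ℕ}
  {𝒮 : StorageScheme F n N Ms Mr}

theorem IsMSR.isMSRCode (h : 𝒮.IsMSR k) :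
    IsMSRCode 𝒮.codewords (fun i j => 𝒮.download i j) k where
  exists_eqOn K hK x := by
    let f : (Fin Ms → F) × (Fin Mr → F) → (K → N → F) := fun y j => 𝒮.encode y.1 y.2 j
    have hf : Function.Injective f := fun y y' hyy =>
      h.injective (h.reconstruct K hK _ ⟨_, _, rfl⟩ _ ⟨_, _, rfl⟩ fun j hj =>
        congrFun hyy ⟨j, hj⟩)
    have hcard : Nat.card (K → N → F) = Nat.card ((Fin Ms → F) × (Fin Mr → F)) := by
      rw [Nat.card_prod, Nat.card_fun, Nat.card_fun, Nat.card_fun, Nat.card_fun, ← pow_add,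
        ← pow_mul]
      congr 1
      have := h.size
      simp only [Nat.card_eq_fintype_card, Fintype.card_fin, Fintype.card_coe, hK]
      rw [mul_comm, ← this, add_comm]
    obtain ⟨y, hy⟩ := (hf.bijective_of_nat_card_le hcard.le).2 fun j => x j
    exact ⟨_, ⟨y.1, y.2, rfl⟩, fun j hj => congrFun hy ⟨j, hj⟩⟩
  eq_of_eqOn := h.reconstruct
  repair := h.repair
  card_eq i := by
    have := 𝒮.finite_download i
    rw [Nat.card_fun, Nat.card_fun, ← pow_mul, mul_comm, h.bandwidth]

theorem IsMSR.pow_mul_le_of_isSecure (h : 𝒮.IsMSR k) (hkn : k < n) {ℓ₁ ℓ₂ : ℕ}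
    (hℓ : ℓ₁ + ℓ₂ < k) (hs : 𝒮.IsSecure (PMF.uniformOfFintype (Fin Ms → F)) ℓ₁ ℓ₂) :
    (n - k) ^ ℓ₂ * Ms ≤ (k - ℓ₁ - ℓ₂) * ((n - k - 1) ^ ℓ₂ * Nat.card N) := by
  classical
  have := 𝒮.finite_download
  have := Fintype.ofFinite N
  obtain ⟨K, -, hK⟩ := Finset.exists_subset_card_eq
    (s := (Finset.univ : Finset (Fin n))) (n := k) (by simpa using hkn.le)
  obtain ⟨E₁, hE₁K, hE₁⟩ := Finset.exists_subset_card_eq (s := K) (n := ℓ₁) (by omega)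
  have hK₁ : (K \ E₁).card = k - ℓ₁ := by rw [Finset.card_sdiff_of_subset hE₁K, hK, hE₁]
  obtain ⟨E₂, hE₂K, hE₂⟩ := Finset.exists_subset_card_eq (s := K \ E₁) (n := ℓ₂) (by omega)
  let J := (K \ E₁) \ E₂
  have hJ : J.card = k - ℓ₁ - ℓ₂ := by rw [Finset.card_sdiff_of_subset hE₂K, hK₁, hE₂]
  -- For each file `s`, the random symbols `ρ s` reproduce the observation of the zero file with
  -- zero randomness.
  choose ρ hρ using fun s => hs.exists_observe_eq hE₁ hE₂ s 0 0
  have hobs₁ : ∀ s, ∀ i ∈ E₁, 𝒮.encode s (ρ s) i = 𝒮.encode 0 0 i := fun s i hi =>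
    congrFun (congrArg Prod.fst (hρ s)) ⟨i, hi⟩
  have hobs₂ : ∀ s, ∀ i ∈ E₂, ∀ j, j ≠ i →
      𝒮.download i j (𝒮.encode s (ρ s) j) = 𝒮.download i j (𝒮.encode 0 0 j) := fun s i hi j hj =>
    congrFun (congrFun (congrArg Prod.snd (hρ s)) ⟨i, hi⟩) ⟨j, hj⟩
  let f : (Fin Ms → F) → (j : J) → IsMSRCode.commonKer 𝒮.download E₂ (j : Fin n) := fun s j =>
    ⟨𝒮.encode s (ρ s) j - 𝒮.encode 0 0 j, by
      rw [IsMSRCode.mem_commonKer]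
      intro i hi
      rw [map_sub, sub_eq_zero]
      refine hobs₂ s i hi j ?_
      rintro rfl
      exact (Finset.mem_sdiff.1 j.2).2 hi⟩
  -- The nodes in `E₁` are fixed, those in `E₂` are repaired from fixed downloads, and `f` records
  -- those in `J`: all of `K` is determined.
  have hf : Function.Injective f := by
    intro s s' hss
    have heq : 𝒮.encode s (ρ s) = 𝒮.encode s' (ρ s') := by
      refine h.reconstruct K hK _ ⟨_, _, rfl⟩ _ ⟨_, _, rfl⟩ fun j hj => ?_
      by_cases hj₁ : j ∈ E₁
      · rw [hobs₁ s j hj₁, hobs₁ s' j hj₁]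
      by_cases hj₂ : j ∈ E₂
      · refine h.repair j _ ⟨_, _, rfl⟩ _ ⟨_, _, rfl⟩ fun m hm => ?_
        rw [hobs₂ s j hj₂ m hm, hobs₂ s' j hj₂ m hm]
      · have := congrArg Subtype.val (congrFun hss
          ⟨j, Finset.mem_sdiff.2 ⟨Finset.mem_sdiff.2 ⟨hj, hj₁⟩, hj₂⟩⟩)
        exact sub_left_injective this
    exact congrArg Prod.fst (h.injective (a₁ := (s, ρ s)) (a₂ := (s', ρ s')) heq)
  have hcard := Nat.card_le_card_of_injective f hf
  rw [Nat.card_fun, Nat.card_pi, Nat.card_eq_fintype_card (α := Fin Ms), Fintype.card_fin] at hcard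
  simp_rw [Module.natCard_eq_pow_finrank (K := F) (V := IsMSRCode.commonKer _ _ _)] at hcard
  rw [Finset.prod_pow_eq_pow_sum, Nat.pow_le_pow_iff_right Finite.one_lt_card] at hcard
  calc _ ≤ (n - k) ^ ℓ₂ * ∑ j : J, Module.finrank F
        (IsMSRCode.commonKer 𝒮.download E₂ (j : Fin n)) := Nat.mul_le_mul_left _ hcard
    _ = ∑ j : J, (n - k) ^ ℓ₂ * Module.finrank F
        (IsMSRCode.commonKer 𝒮.download E₂ (j : Fin n)) := Finset.mul_sum _ _ _
    _ ≤ ∑ _j : J, (n - k - 1) ^ ℓ₂ * Nat.card N := by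
        refine Finset.sum_le_sum fun j _ => ?_
        have := h.isMSRCode.pow_mul_finrank_commonKer_le hkn E₂ j (Finset.mem_sdiff.1 j.2).2
          (by omega)
        rwa [hE₂, Module.finrank_fintype_fun_eq_card, ← Nat.card_eq_fintype_card] at this
    _ = _ := by rw [Finset.sum_const, Finset.card_univ, Fintype.card_coe, hJ, smul_eq_mul]

end StorageScheme

/-! ### The file size -/

theorem secureFileSize_cast {n k ℓ₁ ℓ₂ : ℕ} (hkn : k < n) (hℓ : ℓ₁ + ℓ₂ < k) :
    (secureFileSize n k ℓ₁ ℓ₂ : ℝ) =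
      ((k : ℝ) - ℓ₁ - ℓ₂) * (1 - 1 / ((n : ℝ) - k)) ^ ℓ₂ * ((n : ℝ) - k) ^ (n - 1) := by
  obtain ⟨r, rfl⟩ : ∃ r, n = k + (r + 1) := ⟨n - k - 1, by omega⟩
  obtain ⟨m, hm⟩ : ∃ m, k + (r + 1) - 1 = ℓ₂ + m := ⟨k + r - ℓ₂, by omega⟩
  obtain ⟨d, rfl⟩ : ∃ d, k = ℓ₁ + ℓ₂ + d := ⟨k - ℓ₁ - ℓ₂, by omega⟩
  have h1 : ℓ₁ + ℓ₂ + d - ℓ₁ - ℓ₂ = d := by omega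
  have hr : (r : ℝ) + 1 ≠ 0 := by positivity
  have h2 : 1 - 1 / ((r : ℝ) + 1) = r / (r + 1) := by field_simp; ring
  rw [secureFileSize, hm, h1, Nat.add_sub_cancel_left, Nat.add_sub_cancel_left,
    Nat.add_sub_cancel]
  push_cast
  rw [show (ℓ₁ : ℝ) + ℓ₂ + d - ℓ₁ - ℓ₂ = d by ring,
    show (ℓ₁ : ℝ) + ℓ₂ + d + (r + 1) - (ℓ₁ + ℓ₂ + d) = r + 1 by ring, h2, div_pow, pow_add]
  field_simp

theorem pow_mul_secureFileSize {n k ℓ₁ ℓ₂ : ℕ} (hkn : k < n) (hℓ : ℓ₁ + ℓ₂ < k) :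
    (n - k) ^ ℓ₂ * secureFileSize n k ℓ₁ ℓ₂ =
      (k - ℓ₁ - ℓ₂) * ((n - k - 1) ^ ℓ₂ * (n - k) ^ (n - 1)) := by
  obtain ⟨m, hm⟩ : ∃ m, n - 1 = ℓ₂ + m := ⟨n - 1 - ℓ₂, by omega⟩
  rw [secureFileSize, hm, Nat.add_sub_cancel_left, pow_add]
  ring

theorem secureFileSize_le {n k ℓ₁ ℓ₂ : ℕ} (hkn : k < n) (hℓ : ℓ₁ + ℓ₂ < k) :
    secureFileSize n k ℓ₁ ℓ₂ ≤ k * (n - k) ^ (n - 1) := by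
  refine Nat.le_of_mul_le_mul_left (c := (n - k) ^ ℓ₂) ?_
    (Nat.pow_pos (Nat.sub_pos_of_lt hkn))
  rw [pow_mul_secureFileSize hkn hℓ, mul_left_comm _ k]
  exact Nat.mul_le_mul ((Nat.sub_le _ _).trans (Nat.sub_le _ _))
    (Nat.mul_le_mul_right _ (Nat.pow_le_pow_left (Nat.sub_le _ _) _))

/-! ### The scheme -/

namespace YeBarg

variable {n k : ℕ} {B F : Type*} [Field B] [Field F] [Algebra B F] {γ : B}

theorem blockMatrix_map (v : Fin n) :
    (blockMatrix n k γ v).map (algebraMap B F) = blockMatrix n k (algebraMap B F γ) v := by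
  unfold blockMatrix
  split_ifs with h
  · ext a b
    simp only [Matrix.map_apply, Matrix.of_apply, coeff]
    split_ifs <;> simp
  · exact Matrix.map_one _ (map_zero _) (map_one _)

theorem parityCheck_map :
    (parityCheck n k γ).map (algebraMap B F) = parityCheck n k (algebraMap B F γ) := by
  ext x y
  rw [Matrix.map_apply, parityCheck, parityCheck, Matrix.of_apply, Matrix.of_apply,
    ← blockMatrix_map, ← RingHom.mapMatrix_apply, ← map_pow]
  rfl

theorem algebraMap_comp_mem_code {c : Fin n × Digits n k → B} (hc : c ∈ code n k γ) :
    algebraMap B F ∘ c ∈ code n k (algebraMap B F γ) := by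
  rw [code, LinearMap.mem_ker, Matrix.mulVecLin_apply] at hc ⊢
  funext x
  rw [← parityCheck_map, ← RingHom.map_mulVec, hc]
  simp

variable {G : Matrix (Fin (k * (n - k) ^ (n - 1))) (Fin n × Digits n k) B}

theorem vecMul_map_mem_code (hG : IsGeneratorMatrix n k γ G) (u : Fin (k * (n - k) ^ (n - 1)) → F) :
    Matrix.vecMul u (G.map (algebraMap B F)) ∈ code n k (algebraMap B F γ) := by
  rw [Matrix.vecMul_eq_sum]
  refine Submodule.sum_mem _ fun i _ => Submodule.smul_mem _ _ ?_
  refine algebraMap_comp_mem_code (c := G i) ?_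
  rw [← hG.2]
  exact Submodule.subset_span ⟨i, rfl⟩

/-- A right inverse of `G` over `B` remains one over `F`. -/
theorem vecMul_map_injective (hG : LinearIndependent B G.row) :
    Function.Injective fun u => Matrix.vecMul u (G.map (algebraMap B F)) := by
  obtain ⟨g, hg⟩ := G.vecMulLinear.exists_leftInverse_of_injective
    (LinearMap.ker_eq_bot.2 (Matrix.vecMul_injective_iff.2 hG))
  have hGD : G * LinearMap.toMatrixRight' g = 1 := by
    refine Matrix.ext_of_single_vecMul fun i => ?_
    rw [← Matrix.vecMul_vecMul, Matrix.vecMul_one]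
    have := LinearMap.congr_fun hg (Pi.single i 1)
    rw [← Matrix.toLinearMapRight'_apply, LinearEquiv.symm_apply_apply]
    exact this
  refine Function.LeftInverse.injective
    (g := fun c => Matrix.vecMul c ((LinearMap.toMatrixRight' g).map (algebraMap B F))) fun u => ?_
  change Matrix.vecMul (Matrix.vecMul u _) _ = u
  rw [Matrix.vecMul_vecMul, ← Matrix.map_mul, hGD, Matrix.map_one _ (map_zero _) (map_one _),
    Matrix.vecMul_one]

/-- The point at which the linearized polynomial takes the value of the coordinate `x`. -/
def point (Y : Fin (k * (n - k) ^ (n - 1)) → F)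
    (G : Matrix (Fin (k * (n - k) ^ (n - 1))) (Fin n × Digits n k) B) (x : Fin n × Digits n k) :
    F := ∑ j, G j x • Y j

/-- The points are images of columns of `G` under a linear map, so their span is at most the rank of
the restricted matrix, which rank-nullity computes. -/
theorem finrank_span_point_le (Y : Fin (k * (n - k) ^ (n - 1)) → F) (O : Set (Fin n × Digits n k)) :
    Module.finrank B (Submodule.span B (point Y G '' O)) ≤ k * (n - k) ^ (n - 1) -
      Module.finrank B (LinearMap.ker (G.submatrix id (Subtype.val : O → _)).transpose.mulVecLin) := by
  classical
  let A := G.submatrix id (Subtype.val : O → _)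
  have hspan : Submodule.span B (point Y G '' O) =
      (Submodule.span B (Set.range A.col)).map (Fintype.linearCombination B Y) := by
    rw [Submodule.map_span, ← Set.range_comp]
    congr 1
    ext y
    constructor
    · rintro ⟨x, hx, rfl⟩
      exact ⟨⟨x, hx⟩, rfl⟩
    · rintro ⟨x, rfl⟩
      exact ⟨x, x.2, rfl⟩
  have hrank : Module.finrank B (Submodule.span B (Set.range A.col)) = A.transpose.rank := by
    rw [Matrix.rank_transpose, Matrix.rank_eq_finrank_span_cols]
  have hrn := A.transpose.mulVecLin.finrank_range_add_finrank_ker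
  rw [Module.finrank_fintype_fun_eq_card, Fintype.card_fin] at hrn
  have hle := Submodule.finrank_map_le (Fintype.linearCombination B Y)
    (Submodule.span B (Set.range A.col))
  rw [← hspan, hrank] at hle
  rw [Matrix.rank] at hle
  change _ ≤ _ - Module.finrank B (LinearMap.ker A.transpose.mulVecLin)
  omega

variable [Fintype B]

theorem finrank_ker_restrict_ge (hkn : k < n) {ℓ₁ ℓ₂ : ℕ} (hℓ : ℓ₁ + ℓ₂ < k) {q : ℕ}
    (hγ : IsPrimitiveRoot γ q) (hq : n ≤ q) (hG : IsGeneratorMatrix n k γ G)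
    {E₁ E₂ : Finset (Fin n)} (hE₁ : E₁.card = ℓ₁) (hE₂ : E₂.card = ℓ₂)
    (O : Set (Fin n × Digits n k))
    (hO : ∀ x ∈ O, x.1 ∈ E₁ ∨ ∃ i ∈ E₂, x.1 ≠ i ∧ IsAccessed n k i x.2) :
    secureFileSize n k ℓ₁ ℓ₂ ≤ Module.finrank B
      (LinearMap.ker (G.submatrix id (Subtype.val : O → _)).transpose.mulVecLin) := by
  classical
  have hn : 2 ≤ n := by omega
  let E := E₁ ∪ E₂
  have hE : E.card ≤ ℓ₁ + ℓ₂ := by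
    rw [← hE₁, ← hE₂]
    exact Finset.card_union_le _ _
  obtain ⟨K, hEK, -, hK⟩ := Finset.exists_subsuperset_card_eq
    (s := E) (t := Finset.univ) (n := k) (Finset.subset_univ _) (by omega)
    (by rw [Finset.card_univ, Fintype.card_fin]; omega)
  let D := {a : Digits n k // ∀ i ∈ E₂, ¬ IsAccessed n k i a}
  let J := (K \ E : Finset (Fin n))
  -- Prescribed values on `K`: zero on `E`, and elsewhere free exactly at the coordinates that no
  -- repair in `E₂` accesses.
  let ext : (J × D → B) → Fin n → Digits n k → B := fun w v a =>
    if h : v ∈ J ∧ ∀ i ∈ E₂, ¬ IsAccessed n k i a then w (⟨v, h.1⟩, ⟨a, h.2⟩) else 0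
  have hex : ∀ w : J × D → B, ∃ u, Matrix.vecMul u G ∈ code n k γ ∧
      ∀ v ∈ K, ∀ a, Matrix.vecMul u G (v, a) = ext w v a := by
    intro w
    obtain ⟨c, hc, hcw⟩ := exists_mem_code_eqOn hkn hγ hq hK (ext w)
    have hc' := hc
    rw [← hG.2, ← range_vecMulLinear] at hc'
    obtain ⟨u, rfl⟩ := hc'
    exact ⟨u, hc, hcw⟩
  choose φ hφ hφw using hex
  have hker : ∀ w, φ w ∈ LinearMap.ker (G.submatrix id (Subtype.val : O → _)).transpose.mulVecLin := by
    intro w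
    rw [LinearMap.mem_ker, Matrix.mulVecLin_apply, Matrix.mulVec_transpose]
    funext x
    change Matrix.vecMul (φ w) G (x.1.1, x.1.2) = 0
    have hEz : ∀ v ∈ E, ∀ a, Matrix.vecMul (φ w) G (v, a) = 0 := by
      intro v hv a
      rw [hφw w v (hEK hv)]
      exact dif_neg fun h => (Finset.mem_sdiff.1 h.1).2 hv
    rcases hO x x.2 with hx | ⟨i, hi, hxi, hacc⟩
    · exact hEz _ (Finset.mem_union_left _ hx) _
    · have hiE : i ∈ E := Finset.mem_union_right _ hi
      have hKacc : ∀ j ∈ K, ∀ a, IsAccessed n k i a → Matrix.vecMul (φ w) G (j, a) = 0 := by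
        intro j hj a ha
        rw [hφw w j hj]
        exact dif_neg fun h => h.2 i hi ha
      by_cases hxK : x.1.1 ∈ K
      · exact hKacc _ hxK _ hacc
      -- Outside `K`, alignment with the zero codeword applies: node `i` and all downloads for it
      -- from `K` vanish.
      · have := (isMSRCode hkn hn hγ hq).download_eq_of_download_eq hK (hEK hiE)
          (c := fun v a => Matrix.vecMul (φ w) G (v, a)) (c' := 0) (hφ w)
          ((code n k γ).zero_mem) (funext fun a => hEz i hiE a)
          (fun j hj _ => funext fun a => hKacc j hj a a.2) hxK
        exact congrFun this ⟨x.1.2, hacc⟩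
  have hinj : Function.Injective fun w =>
      (⟨φ w, hker w⟩ : LinearMap.ker (G.submatrix id (Subtype.val : O → _)).transpose.mulVecLin) := by
    intro w w' hww
    have hφφ : φ w = φ w' := congrArg Subtype.val hww
    funext y
    have hy : (y.1 : Fin n) ∈ J ∧ ∀ i ∈ E₂, ¬ IsAccessed n k i y.2.1 := ⟨y.1.2, y.2.2⟩
    have hyK : (y.1 : Fin n) ∈ K := (Finset.mem_sdiff.1 y.1.2).1
    have h1 := hφw w y.1 hyK y.2
    have h2 := hφw w' y.1 hyK y.2
    rw [hφφ, h2] at h1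
    simpa only [ext, dif_pos hy] using h1.symm
  have hcard := Nat.card_le_card_of_injective _ hinj
  rw [Nat.card_fun, Module.natCard_eq_pow_finrank (K := B)
      (V := LinearMap.ker (G.submatrix id (Subtype.val : O → _)).transpose.mulVecLin),
    Nat.pow_le_pow_iff_right Finite.one_lt_card, Nat.card_prod,
    card_forall_not_isAccessed hkn (by omega), hE₂, Nat.card_eq_fintype_card, Fintype.card_coe,
    Finset.card_sdiff_of_subset hEK, hK] at hcard
  -- `E₁` and `E₂` may overlap, so `K \ E` has at least, not exactly, `k - ℓ₁ - ℓ₂` nodes.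
  exact (Nat.mul_le_mul_right _ (by omega)).trans hcard

variable {Y : Fin (k * (n - k) ^ (n - 1)) → F}

/-- The linearized polynomial is `B`-linear and `G` has entries in `B`, so evaluation commutes with
encoding. -/
theorem secureScheme_encode_apply {Ms : ℕ} (s : Fin Ms → F) (r) (v : Fin n) (a : Digits n k) :
    (secureScheme n k Y G Ms).encode s r v a =
      linearizedEval B (randomThenFile s r) (point Y G (v, a)) := by
  change ∑ j, gabidulinPrecode (Fintype.card B) (randomThenFile s r) Y j *
    algebraMap B F (G j (v, a)) = _
  rw [point, map_sum]
  refine Finset.sum_congr rfl fun j _ => ?_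
  rw [map_smul, Algebra.smul_def, mul_comm, gabidulinPrecode,
    eval_linearizedPoly]

theorem secureScheme_isMSR (hkn : k < n) (hn : 2 ≤ n) {q : ℕ}
    (hγ : IsPrimitiveRoot γ q) (hq : n ≤ q) (hG : IsGeneratorMatrix n k γ G)
    (hY : LinearIndependent B Y) {Ms : ℕ} (hMs : Ms ≤ k * (n - k) ^ (n - 1)) :
    (secureScheme n k Y G Ms).IsMSR k := by
  have hMSR := isMSRCode (γ := algebraMap B F γ) hkn hn
    (hγ.map_of_injective (algebraMap B F).injective) hq
  have hmem : ∀ c ∈ (secureScheme n k Y G Ms).codewords,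
      c ∈ {c : Fin n → Digits n k → F |
        (fun x : Fin n × Digits n k => c x.1 x.2) ∈ code n k (algebraMap B F γ)} := by
    rintro _ ⟨s, r, rfl⟩
    exact vecMul_map_mem_code hG _
  refine ⟨?_, ?_, ?_, ?_, ?_⟩
  · simp [hMs]
  · intro x x' hxx
    have h1 : gabidulinPrecode (Fintype.card B) (randomThenFile x.1 x.2) Y =
        gabidulinPrecode (Fintype.card B) (randomThenFile x'.1 x'.2) Y :=
      vecMul_map_injective (F := F) hG.1 (funext fun y => congrFun (congrFun hxx y.1) y.2)
    have h2 : randomThenFile (K := k * (n - k) ^ (n - 1)) x.1 x.2 = randomThenFile x'.1 x'.2 := by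
      rw [← sub_eq_zero]
      refine eq_zero_of_linearizedEval_eq_zero (B := B) (by simp) hY fun j => ?_
      have := congrFun h1 j
      rw [gabidulinPrecode, gabidulinPrecode, eval_linearizedPoly, eval_linearizedPoly] at this
      rw [← add_left_inj (linearizedEval B (randomThenFile x'.1 x'.2) (Y j)), ← linearizedEval_add,
        sub_add_cancel, this, zero_add]
    refine Prod.ext (funext fun i => ?_) (funext fun i => ?_)
    · have := congrFun h2 ⟨k * (n - k) ^ (n - 1) - Ms + i, by omega⟩
      simpa [randomThenFile] using this
    · have := congrFun h2 ⟨i, by omega⟩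
      simpa [randomThenFile] using this
  · exact fun K hK c hc c' hc' h => hMSR.eq_of_eqOn K hK c (hmem c hc) c' (hmem c' hc') h
  · exact fun i => card_isAccessed hkn hn i
  · exact fun i c hc c' hc' h => hMSR.repair i c (hmem c hc) c' (hmem c' hc') h

theorem secureScheme_isSecure [Fintype F] (hkn : k < n) {ℓ₁ ℓ₂ : ℕ} (hℓ : ℓ₁ + ℓ₂ < k) {q : ℕ}
    (hγ : IsPrimitiveRoot γ q) (hq : n ≤ q) (hG : IsGeneratorMatrix n k γ G)
    (p : PMF (Fin (secureFileSize n k ℓ₁ ℓ₂) → F)) :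
    (secureScheme n k Y G (secureFileSize n k ℓ₁ ℓ₂)).IsSecure p ℓ₁ ℓ₂ := by
  refine StorageScheme.isSecure_of_forall_exists_add _ (fun E₁ E₂ hE₁ hE₂ s => ?_) p
  let O : Set (Fin n × Digits n k) :=
    {x | x.1 ∈ E₁ ∨ ∃ i ∈ E₂, x.1 ≠ i ∧ IsAccessed n k i x.2}
  have hker := finrank_ker_restrict_ge hkn hℓ hγ hq hG hE₁ hE₂ O fun _ hx => hx
  have hZ := finrank_span_point_le (G := G) Y O
  -- The shift `r₀` makes the zero file agree with `s` at every observed point.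
  obtain ⟨r₀, hr₀⟩ := exists_linearizedEval_randomThenFile_eq
    (Z := Submodule.span B (point Y G '' O)) (hZ.trans (Nat.sub_le_sub_left hker _))
    (linearizedEval B (randomThenFile s 0))
  have key : ∀ r v a, (v, a) ∈ O →
      (secureScheme n k Y G (secureFileSize n k ℓ₁ ℓ₂)).encode s r v a =
        (secureScheme n k Y G (secureFileSize n k ℓ₁ ℓ₂)).encode 0 (r + r₀) v a := by
    intro r v a hx
    have h1 := randomThenFile_add s 0 0 r
    have h2 := randomThenFile_add (0 : Fin (secureFileSize n k ℓ₁ ℓ₂) → F) 0 r₀ r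
    rw [add_zero, zero_add] at h1
    rw [add_zero, add_comm r₀] at h2
    rw [secureScheme_encode_apply, secureScheme_encode_apply, h1, h2, linearizedEval_add,
      linearizedEval_add, hr₀ _ (Submodule.subset_span ⟨_, hx, rfl⟩)]
  refine ⟨r₀, fun r => Prod.ext ?_ ?_⟩
  · funext i a
    exact key r i a (Or.inl i.2)
  · funext i j a
    change {a : Digits n k // IsAccessed n k i a} at a
    exact key r j a (Or.inr ⟨i, i.2, j.2, a.2⟩)

end YeBarg

end

theorem proposition1 (n k ℓ₁ ℓ₂ : ℕ) (hkn : k < n) (hℓ : ℓ₁ + ℓ₂ < k)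
    {B F : Type*} [Field B] [Fintype B] [Field F] [Fintype F] [Algebra B F]
    (hB : n + 1 ≤ Fintype.card B)
    (hQ : k * (n - k) ^ (n - 1) ≤ Module.finrank B F)
    (γ : B) (hγ : IsPrimitiveRoot γ (Fintype.card B - 1)) :
    -- the secure file size
    ((secureFileSize n k ℓ₁ ℓ₂ : ℝ) =
      ((k : ℝ) - ℓ₁ - ℓ₂) * (1 - 1 / ((n : ℝ) - k)) ^ ℓ₂ * ((n : ℝ) - k) ^ (n - 1)) ∧
    -- the code has a generator matrix of the size that the scheme uses
    (∃ G, YeBarg.IsGeneratorMatrix n k γ G) ∧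
    -- for all linearly independent points and every generator matrix, the scheme is a linear
    -- repairable MSR scheme, and secure against every eavesdropper, for every law of the file
    (∀ (Y : Fin (k * (n - k) ^ (n - 1)) → F)
      (G : Matrix (Fin (k * (n - k) ^ (n - 1))) (Fin n × YeBarg.Digits n k) B),
      LinearIndependent B Y → YeBarg.IsGeneratorMatrix n k γ G →
      (secureScheme n k Y G (secureFileSize n k ℓ₁ ℓ₂)).IsMSR k ∧
      ∀ p : PMF (Fin (secureFileSize n k ℓ₁ ℓ₂) → F),
        (secureScheme n k Y G (secureFileSize n k ℓ₁ ℓ₂)).IsSecure p ℓ₁ ℓ₂) ∧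
    -- this file size is the secrecy capacity
    IsGreatest (achievableSizes F n k (YeBarg.Digits n k) ℓ₁ ℓ₂) (secureFileSize n k ℓ₁ ℓ₂) := by
  have hn : 2 ≤ n := by omega
  have hq : n ≤ Fintype.card B - 1 := Nat.le_sub_one_of_lt hB
  have hsize := secureFileSize_le hkn hℓ
  have hscheme : ∀ (Y : Fin (k * (n - k) ^ (n - 1)) → F)
      (G : Matrix (Fin (k * (n - k) ^ (n - 1))) (Fin n × YeBarg.Digits n k) B),
      LinearIndependent B Y → YeBarg.IsGeneratorMatrix n k γ G →
      (secureScheme n k Y G (secureFileSize n k ℓ₁ ℓ₂)).IsMSR k ∧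
      ∀ p : PMF (Fin (secureFileSize n k ℓ₁ ℓ₂) → F),
        (secureScheme n k Y G (secureFileSize n k ℓ₁ ℓ₂)).IsSecure p ℓ₁ ℓ₂ :=
    fun Y G hY hG => ⟨YeBarg.secureScheme_isMSR hkn hn hγ hq hG hY hsize,
      YeBarg.secureScheme_isSecure hkn hℓ hγ hq hG⟩
  have hG := YeBarg.exists_isGeneratorMatrix hkn hγ hq
  refine ⟨secureFileSize_cast hkn hℓ, hG, hscheme, ?_, ?_⟩
  · obtain ⟨Y, hY⟩ := exists_linearIndependent_of_le_finrank hQ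
    obtain ⟨G, hG⟩ := hG
    exact ⟨_, _, (hscheme Y G hY hG).1, (hscheme Y G hY hG).2 _⟩
  · rintro Ms ⟨Mr, 𝒮, hMSR, hsec⟩
    have h := hMSR.pow_mul_le_of_isSecure hkn hℓ hsec
    rw [Nat.card_fun, Nat.card_eq_fintype_card, Nat.card_eq_fintype_card, Fintype.card_fin,
      Fintype.card_fin, ← pow_mul_secureFileSize hkn hℓ] at h
    exact Nat.le_of_mul_le_mul_left h (Nat.pow_pos (Nat.sub_pos_of_lt hkn))
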